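/- Let $p\ge 0$ and let $f:\mathbb R^p\to\mathbb R$ be twice continuously differentiable with $\int e^{f(y)}\,dy<\infty$; let $\mathbb P_f$ be the probability measure on $\mathbb R^p$ with density $e^{f(y)}/\int e^{f}$. Let $x^*$ be a point of maximum of $f$ and assume that $D_G^2:=-\nabla^2 f(x^*)$ is positive definite. Let $G^2$ be a symmetric positive semidefinite matrix such that $u\mapsto f(x^*+u)+\|Gu\|^2/2$ is concave on $\mathbb R^p$, where $\|Gu\|^2=u^\top G^2u$; set $D^2:=D_G^2-G^2$ and write $\|Du\|^2=u^\top D^2u$ (this is nonnegative by the concavity). Fix $\mathtt x>0$ and $\nu\in(0,1)$ and set $$\mathtt p_G=\operatorname{tr}(D^2D_G^{-2}),\qquad \mathtt r_G=2\sqrt{\mathtt p_G}+\sqrt{2\mathtt x},\qquad \mathcal U=\{u\in\mathbb R^p:\ \|Du\|\le\nu^{-1}\mathtt r_G\},$$ $$\delta_3(u)=f(x^*+u)-f(x^*)-\langle\nabla f(x^*),u\rangle-\tfrac12\langle\nabla^2f(x^*)u,u\rangle,\qquad \omega=\sup_{u\in\mathcal U}\frac{|\delta_3(u)|}{\|Du\|^2/2}$$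 (with $0/0=0$ and $c/0=\infty$ for $c>0$). Assume $\omega\le 1/3$, $\omega\le 1-\nu$ and $\omega\,\mathtt p_G\le 2/3$. Let $\tau_3:\mathbb R^p\to\mathbb R$ satisfy $\tau_3(tu)=t^3\tau_3(u)$ for all $t>0$, $u\in\mathbb R^p$, and $|\delta_3(u)|\le\tau_3(u)/6$ for all $u\in\mathcal U$, and let $\tau_3$ be integrable with respect to $\mathcal N(0,D_G^{-2})$. Put $$\diamondsuit_3=\frac{\mathbb E\,\tau_3(\gamma_G)}{4(1-\omega)^{3/2}},\qquad \gamma_G\sim\mathcal N(0,D_G^{-2}).$$ If $4\diamondsuit_3+4e^{-\mathtt x}\le 1$, then $$\mathrm{KL}\bigl(\mathbb P_f,\ \mathcal N(x^*,D_G^{-2})\bigr)\ \le\ 4\diamondsuit_3+4e^{-\mathtt x}.$$ -/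

import Mathlib

open MeasureTheory
open scoped ENNReal

noncomputable section

namespace LaplaceKL

/-- The quadratic form `u ↦ uᵀ A u`. For `A = M²` with `M` symmetric this is `‖M u‖²`. -/
def qf {p : ℕ} (A : Matrix (Fin p) (Fin p) ℝ) (u : EuclideanSpace ℝ (Fin p)) : ℝ :=
  u.ofLp ⬝ᵥ A.mulVec u.ofLp

/-- The Hessian matrix `∇² f(a)` in the standard basis. -/
def hessian {p : ℕ} (f : EuclideanSpace ℝ (Fin p) → ℝ) (a : EuclideanSpace ℝ (Fin p)) :
    Matrix (Fin p) (Fin p) ℝ :=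
  Matrix.of fun i j =>
    iteratedFDeriv ℝ 2 f a ![EuclideanSpace.single i 1, EuclideanSpace.single j 1]

/-- `D_G² = -∇² f(a)`. -/
def DG2 {p : ℕ} (f : EuclideanSpace ℝ (Fin p) → ℝ) (a : EuclideanSpace ℝ (Fin p)) :
    Matrix (Fin p) (Fin p) ℝ :=
  -hessian f a

/-- `D² = D_G² - G²`, the negative Hessian at `a` of `ℓ(a + u) = f(a + u) + ‖G u‖² / 2`. -/
def D2 {p : ℕ} (f : EuclideanSpace ℝ (Fin p) → ℝ) (a : EuclideanSpace ℝ (Fin p))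
    (G2 : Matrix (Fin p) (Fin p) ℝ) : Matrix (Fin p) (Fin p) ℝ :=
  DG2 f a - G2

/-- The effective dimension `p_G = tr(D² D_G⁻²)`. -/
def effDim {p : ℕ} (f : EuclideanSpace ℝ (Fin p) → ℝ) (a : EuclideanSpace ℝ (Fin p))
    (G2 : Matrix (Fin p) (Fin p) ℝ) : ℝ :=
  (D2 f a G2 * (DG2 f a)⁻¹).trace

/-- The radius `r_G = 2 √p_G + √(2 x)`. -/
def radius {p : ℕ} (f : EuclideanSpace ℝ (Fin p) → ℝ) (a : EuclideanSpace ℝ (Fin p))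
    (G2 : Matrix (Fin p) (Fin p) ℝ) (x : ℝ) : ℝ :=
  2 * √(effDim f a G2) + √(2 * x)

/-- The local set `U = {u : ‖D u‖ ≤ ν⁻¹ r_G}`. -/
def localSet {p : ℕ} (f : EuclideanSpace ℝ (Fin p) → ℝ) (a : EuclideanSpace ℝ (Fin p))
    (G2 : Matrix (Fin p) (Fin p) ℝ) (x ν : ℝ) : Set (EuclideanSpace ℝ (Fin p)) :=
  {u | √(qf (D2 f a G2) u) ≤ ν⁻¹ * radius f a G2 x}

/-- The third order Taylor remainder
`δ₃(a, u) = f(a + u) - f(a) - ⟨∇f(a), u⟩ - ⟨∇²f(a), u ⊗ u⟩ / 2`. -/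
def delta3 {p : ℕ} (f : EuclideanSpace ℝ (Fin p) → ℝ) (a u : EuclideanSpace ℝ (Fin p)) : ℝ :=
  f (a + u) - f a - fderiv ℝ f a u - qf (hessian f a) u / 2

/-- `ω = sup_{u ∈ U} |δ₃(a, u)| / (‖D u‖² / 2)`, as an extended nonnegative number
(so that `0 / 0 = 0` and `c / 0 = ∞` for `c > 0`). -/
def omega {p : ℕ} (f : EuclideanSpace ℝ (Fin p) → ℝ) (a : EuclideanSpace ℝ (Fin p))
    (G2 : Matrix (Fin p) (Fin p) ℝ) (x ν : ℝ) : ℝ≥0∞ :=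
  ⨆ u ∈ localSet f a G2 x ν,
    ENNReal.ofReal |delta3 f a u| / ENNReal.ofReal (qf (D2 f a G2) u / 2)

/-- `♦₃ = E τ₃(γ_G) / (4 (1 - ω)^{3/2})` with `γ_G ∼ N(0, D_G⁻²)`. -/
def diamond3 {p : ℕ} (f : EuclideanSpace ℝ (Fin p) → ℝ) (a : EuclideanSpace ℝ (Fin p))
    (G2 : Matrix (Fin p) (Fin p) ℝ) (x ν : ℝ) (τ₃ : EuclideanSpace ℝ (Fin p) → ℝ) : ℝ :=
  (∫ u, τ₃ u ∂(ProbabilityTheory.multivariateGaussian 0 (DG2 f a)⁻¹)) /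
    (4 * (1 - (omega f a G2 x ν).toReal) ^ (3 / 2 : ℝ))

end LaplaceKL

end

namespace LaplaceKL

open ProbabilityTheory Matrix WithLp Real InformationTheory Filter
open scoped RealInnerProductSpace MatrixOrder Topology

/-! ### Quadratic forms of matrices on Euclidean space. -/

section QuadraticForm

variable {p : ℕ}

local notation "E" => EuclideanSpace ℝ (Fin p)
local notation "Mat" => Matrix (Fin p) (Fin p) ℝ

/-! Write B = D_G², A = D², μ = N(0, B⁻¹), δ = δ₃, q = `qf A`, k = tr(A B⁻¹). Since ∇f(x*) = 0, the
measure P_f is the translate by x* of μ tilted by δ. With Z = ∫ e^δ dμ, the inequality log Z ≥ 1 -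
1/Z gives KL ≤ Z⁻¹ ∫ klFun(e^δ) dμ (`klDiv_tilted_le`). The smallness assumption gives Z ≥ 3/4, so
it remains to bound the integral of klFun(e^δ) = (δ - 1)e^δ + 1 inside and outside the set q < R²,
where R = r_G/ν.

Inside (`lintegral_local_le`), the target is a multiple of E|δ|, although δ may be as large as ωq/2
and e^δ is not bounded uniformly in the dimension. Exponential factors are removed by Gaussian
integration by parts along the field u ↦ B⁻¹Au, which trades multiplication by q - k for a
derivative (`integral_mul_qf_sub_trace`). The test function is ψ(δ)/q times a cutoff that does not
increase along the field, so the cutoff contributes with a favourable sign. Concavity of δ - q/2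
bounds the derivative of δ along the field from above (`fderiv_inv_mul_le`), and ψ is chosen so that
what remains dominates (1-ω)/2 · klFun(e^δ) - 2δ where δ > 0 (`psi_test_inequality`, which uses ω ≤
1/3 and ωk ≤ 2/3). Where δ ≤ 0, klFun(e^δ) ≤ |δ| directly.

Outside (`lintegral_tail_le`), concavity along rays gives δ ≤ √q(√q - r)/2 with r = r_G
(`le_of_sq_le_qf`). A Chernoff bound for q under μ (`measureReal_sq_le_qf_le`) beats this growth,
and a layer-cake integral over √q - r yields 3e^{-x}. -/

lemma qf_eq_inner (A : Mat) (u : E) : qf A u = ⟪u, toEuclideanCLM (𝕜 := ℝ) A u⟫ :=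
  (inner_toEuclideanCLM A u u).symm

lemma qf_nonneg {A : Mat} (hA : A.PosSemidef) (u : E) : 0 ≤ qf A u := by
  simpa [qf] using hA.dotProduct_mulVec_nonneg u.ofLp

lemma qf_sub_left (A B : Mat) (u : E) : qf (A - B) u = qf A u - qf B u := by
  simp [qf, Matrix.sub_mulVec]

lemma qf_neg_left (A : Mat) (u : E) : qf (-A) u = -qf A u := by
  simp [qf, Matrix.neg_mulVec]

lemma qf_smul (A : Mat) (t : ℝ) (u : E) : qf A (t • u) = t ^ 2 * qf A u := by
  simp [qf, Matrix.mulVec_smul]; ring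

lemma inner_toEuclideanCLM_comm {A : Mat} (hA : A.IsHermitian) (u v : E) :
    ⟪u, toEuclideanCLM (𝕜 := ℝ) A v⟫ = ⟪toEuclideanCLM (𝕜 := ℝ) A u, v⟫ := by
  rw [real_inner_comm v, inner_toEuclideanCLM, inner_toEuclideanCLM, Matrix.dotProduct_mulVec,
    ← Matrix.mulVec_transpose, dotProduct_comm]
  have : Aᵀ = A := by simpa [Matrix.IsHermitian] using hA
  rw [this]

lemma qf_sub {A : Mat} (hA : A.IsHermitian) (u v : E) :
    qf A (u - v) = qf A u - 2 * ⟪toEuclideanCLM (𝕜 := ℝ) A u, v⟫ + qf A v := by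
  simp only [qf_eq_inner, map_sub, inner_sub_left, inner_sub_right]
  rw [inner_toEuclideanCLM_comm hA u v, real_inner_comm (toEuclideanCLM (𝕜 := ℝ) A u) v]
  ring

lemma contDiff_qf (A : Mat) {n : WithTop ℕ∞} : ContDiff ℝ n (qf A : E → ℝ) := by
  have : (qf A : E → ℝ) = fun u => ⟪u, toEuclideanCLM (𝕜 := ℝ) A u⟫ := funext (qf_eq_inner A)
  rw [this]
  exact contDiff_id.inner ℝ (toEuclideanCLM (𝕜 := ℝ) A).contDiff

@[fun_prop]
lemma continuous_qf (A : Mat) : Continuous (qf A : E → ℝ) := (contDiff_qf A (n := 0)).continuous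

lemma hasFDerivAt_qf {A : Mat} (hA : A.IsHermitian) (u : E) :
    HasFDerivAt (qf A : E → ℝ) ((2 : ℝ) • innerSL ℝ (toEuclideanCLM (𝕜 := ℝ) A u)) u := by
  have h : (qf A : E → ℝ) = fun u => ⟪u, toEuclideanCLM (𝕜 := ℝ) A u⟫ := funext (qf_eq_inner A)
  rw [h]
  have := (hasFDerivAt_id u).inner ℝ (toEuclideanCLM (𝕜 := ℝ) A).hasFDerivAt
  refine this.congr_fderiv ?_
  ext v
  simp only [id_eq, ContinuousLinearMap.coe_comp, Function.comp_apply,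
    ContinuousLinearMap.prod_apply, fderivInnerCLM_apply, _root_.smul_apply,
    innerSL_apply_apply, smul_eq_mul, ContinuousLinearMap.coe_id']
  rw [inner_toEuclideanCLM_comm hA u v, real_inner_comm (toEuclideanCLM (𝕜 := ℝ) A u) v]
  ring

/-- Cauchy–Schwarz for a positive semidefinite matrix. -/
lemma inner_toEuclideanCLM_sq_le {A : Mat} (hA : A.PosSemidef) (u v : E) :
    ⟪toEuclideanCLM (𝕜 := ℝ) A u, v⟫ ^ 2 ≤ qf A u * qf A v := by
  have h : ∀ t : ℝ, 0 ≤ qf A v * (t * t) + (-2 * ⟪toEuclideanCLM (𝕜 := ℝ) A u, v⟫) * t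
      + qf A u := by
    intro t
    have := qf_nonneg hA (u - t • v)
    rw [qf_sub hA.1, qf_smul, inner_smul_right] at this
    linarith
  have := discrim_le_zero h
  rw [discrim] at this
  nlinarith

end QuadraticForm

/-! ### Exponential tilting under maps and scaling. -/

section Tilted

variable {α β : Type*} {mα : MeasurableSpace α} {mβ : MeasurableSpace β}

lemma map_tilted {μ : Measure α} {e : α → β} (he : Measurable e) {g : β → ℝ} (hg : Measurable g) :
    (μ.tilted (g ∘ e)).map e = (μ.map e).tilted g := by
  ext s hs
  rw [Measure.map_apply he hs, tilted_apply' _ _ (he hs), tilted_apply' _ _ hs,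
    setLIntegral_map hs (by fun_prop) he]
  rw [integral_map he.aemeasurable (by fun_prop)]
  rfl

lemma smul_tilted {μ : Measure α} {c : ℝ≥0∞} (h0 : c ≠ 0) (h1 : c ≠ ∞) (g : α → ℝ) :
    (c • μ).tilted g = μ.tilted g := by
  rw [Measure.tilted, Measure.tilted, withDensity_smul_measure, integral_smul_measure,
    ← withDensity_smul' _ _ h1]
  congr 1
  ext x
  have hc : 0 < c.toReal := ENNReal.toReal_pos h0 h1
  have : c = ENNReal.ofReal c.toReal := (ENNReal.ofReal_toReal h1).symm
  simp only [Pi.smul_apply, smul_eq_mul]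
  rw [this, ← ENNReal.ofReal_mul (by positivity), ENNReal.toReal_ofReal hc.le]
  congr 1
  by_cases hz : ∫ x, rexp (g x) ∂μ = 0
  · simp [hz]
  · field_simp

end Tilted

/-! ### Gaussian measures as tilts of Lebesgue measure. -/

section Gaussian

variable {p : ℕ}

local notation "E" => EuclideanSpace ℝ (Fin p)
local notation "Mat" => Matrix (Fin p) (Fin p) ℝ

lemma integrable_exp_neg_norm_sq : Integrable (fun u : E => rexp (-(‖u‖ ^ 2 / 2))) := by
  have := (GaussianFourier.integrable_cexp_neg_mul_sq_norm_add (V := E) (b := 1 / 2)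
    (by norm_num) 0 0).re
  refine this.congr (ae_of_all _ fun u => ?_)
  have h : (-(1 / 2 : ℂ) * (‖u‖ : ℂ) ^ 2 + 0 * (⟪(0 : E), u⟫ : ℝ)) = ((-(‖u‖ ^ 2 / 2) : ℝ) : ℂ) := by
    push_cast; ring
  simp only [h, ← Complex.ofReal_exp]
  exact Complex.ofReal_re _

/-- Both sides have the same characteristic function, by the Gaussian Fourier integral. -/
lemma stdGaussian_eq_tilted :
    stdGaussian E = volume.tilted (fun u : E => -(‖u‖ ^ 2 / 2)) := by
  have := isProbabilityMeasure_tilted (integrable_exp_neg_norm_sq (p := p))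
  apply Measure.ext_of_charFun
  ext t
  rw [charFun_stdGaussian, charFun_apply, integral_tilted]
  have h0 : (∫ u : E, rexp (-(‖u‖ ^ 2 / 2))) = (π / (1 / 2)) ^ (Module.finrank ℝ E / 2 : ℝ) := by
    rw [← GaussianFourier.integral_rexp_neg_mul_sq_norm (V := E) (b := 1 / 2) (by norm_num)]
    congr 1; ext u; congr 1; ring
  have h0' : (∫ u : E, rexp (-(‖u‖ ^ 2 / 2))) ≠ 0 := by
    rw [h0]; positivity
  have h1 := GaussianFourier.integral_cexp_neg_mul_sq_norm_add (V := E) (b := 1 / 2)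
    (by norm_num) Complex.I t
  have h2 : ((∫ u : E, rexp (-(‖u‖ ^ 2 / 2)) : ℝ) : ℂ)
      = (π / (1 / 2)) ^ (Module.finrank ℝ E / 2 : ℂ) := by
    rw [h0, Complex.ofReal_cpow (by positivity)]; push_cast; rfl
  have h3 : ∀ u : E, (rexp (-(‖u‖ ^ 2 / 2)) / ∫ u : E, rexp (-(‖u‖ ^ 2 / 2))) •
      Complex.exp (⟪u, t⟫ * Complex.I) = (((∫ u : E, rexp (-(‖u‖ ^ 2 / 2)) : ℝ) : ℂ))⁻¹ *
      Complex.exp (-(1 / 2) * ‖u‖ ^ 2 + Complex.I * ⟪t, u⟫) := by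
    intro u
    rw [Complex.exp_add, real_inner_comm u t, Complex.real_smul]
    push_cast
    rw [mul_comm Complex.I]
    rw [show -((‖u‖ : ℂ) ^ 2 / 2) = -(1 / 2) * ‖u‖ ^ 2 by ring]
    ring
  simp_rw [h3]
  rw [integral_const_mul, h1, ← h2, ← mul_assoc, inv_mul_cancel₀ (by exact_mod_cast h0'), one_mul]
  congr 1
  rw [Complex.I_sq]; ring

lemma sqrt_inv_mul_self {B : Mat} (hB : B.PosDef) : CFC.sqrt B⁻¹ * CFC.sqrt B⁻¹ = B⁻¹ :=
  CFC.sqrt_mul_sqrt_self _ hB.inv.posSemidef.nonneg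

lemma isHermitian_sqrt_inv {B : Mat} : (CFC.sqrt B⁻¹).IsHermitian :=
  (CFC.sqrt_nonneg B⁻¹).isSelfAdjoint

lemma sqrt_inv_conj {B : Mat} (hB : B.PosDef) : CFC.sqrt B⁻¹ * B * CFC.sqrt B⁻¹ = 1 := by
  have h : (B * CFC.sqrt B⁻¹) * CFC.sqrt B⁻¹ = 1 := by
    rw [mul_assoc, sqrt_inv_mul_self hB]
    exact Matrix.mul_nonsing_inv _ ((Matrix.isUnit_iff_isUnit_det _).1 hB.isUnit)
  rw [mul_assoc]
  exact mul_eq_one_comm.1 h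

lemma qf_conj {s : Mat} (hs : s.IsHermitian) (A : Mat) (u : E) :
    qf A (toEuclideanCLM (𝕜 := ℝ) s u) = qf (s * A * s) u := by
  rw [qf_eq_inner, qf_eq_inner, ← inner_toEuclideanCLM_comm hs]
  simp [map_mul]

lemma qf_one (u : E) : qf 1 u = ‖u‖ ^ 2 := by
  rw [qf_eq_inner]; simp

/-- The left side is the image of the standard Gaussian under u ↦ a + B^{-1/2}u. This map scales
Lebesgue measure by a constant Jacobian, which the normalisation of a tilt absorbs. -/
lemma multivariateGaussian_eq_tilted {B : Mat} (hB : B.PosDef) (a : E) :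
    multivariateGaussian a B⁻¹ = volume.tilted (fun y : E => -(qf B (y - a) / 2)) := by
  set T := toEuclideanCLM (𝕜 := ℝ) (CFC.sqrt B⁻¹) with hT
  have hcomp : (fun u : E => -(‖u‖ ^ 2 / 2)) = (fun y : E => -(qf B (y - a) / 2)) ∘
      (fun u => a + T u) := by
    ext u
    simp [hT, qf_conj isHermitian_sqrt_inv, sqrt_inv_conj hB, qf_one]
  have hdet : LinearMap.det (T : E →ₗ[ℝ] E) ≠ 0 := by
    have h1 : (CFC.sqrt B⁻¹ * B) * CFC.sqrt B⁻¹ = 1 := sqrt_inv_conj hB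
    have h2 : (toEuclideanCLM (𝕜 := ℝ) (CFC.sqrt B⁻¹ * B) : E →ₗ[ℝ] E) ∘ₗ (T : E →ₗ[ℝ] E)
        = LinearMap.id := by
      ext1 u
      have := congrArg (fun M : Mat => toEuclideanCLM (𝕜 := ℝ) M u) h1
      simpa [hT, map_mul] using this
    have h3 := congrArg LinearMap.det h2
    rw [LinearMap.det_comp, LinearMap.det_id] at h3
    exact right_ne_zero_of_mul_eq_one h3
  have hmap : (volume : Measure E).map (fun u => a + T u)
      = ENNReal.ofReal |(LinearMap.det (T : E →ₗ[ℝ] E))⁻¹| • volume := by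
    have h1 := Measure.map_linearMap_addHaar_eq_smul_addHaar (volume : Measure E) hdet
    have h2 : (fun u => a + T u) = (fun y => a + y) ∘ T := rfl
    rw [h2, ← Measure.map_map (measurable_const_add a) (by fun_prop)]
    change ((volume : Measure E).map (T : E →ₗ[ℝ] E)).map _ = _
    rw [h1, Measure.map_smul, map_add_left_eq_self]
  rw [multivariateGaussian, stdGaussian_eq_tilted, hcomp,
    map_tilted (by fun_prop) (by fun_prop), hmap,
    smul_tilted (by simpa using hdet) ENNReal.ofReal_ne_top]

lemma integrable_exp_neg_qf {B : Mat} (hB : B.PosDef) (a : E) :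
    Integrable (fun y : E => rexp (-(qf B (y - a) / 2))) := by
  by_contra h
  have h1 := multivariateGaussian_eq_tilted hB a
  -- Without integrability the tilt is the zero measure by convention, but here it equals a
  -- probability measure.
  rw [tilted_of_not_integrable h] at h1
  exact IsProbabilityMeasure.ne_zero _ h1

end Gaussian

/-! ### Chernoff bounds for Gaussian quadratic forms. -/

section Concentration

variable {p : ℕ}

local notation "E" => EuclideanSpace ℝ (Fin p)
local notation "Mat" => Matrix (Fin p) (Fin p) ℝ

lemma integrable_exp_mul_sq_gaussianReal {t : ℝ} (ht : 2 * t < 1) :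
    Integrable (fun x => rexp (t * x ^ 2)) (gaussianReal 0 1) := by
  rw [gaussianReal_of_var_ne_zero _ one_ne_zero, integrable_withDensity_iff
    (measurable_gaussianPDF _ _) (ae_of_all _ fun x => by simp [gaussianPDF])]
  have h := (integrable_exp_neg_mul_sq (b := 1 / 2 - t) (by linarith)).const_mul (√(2 * π))⁻¹
  refine h.congr (ae_of_all _ fun x => ?_)
  simp only [toReal_gaussianPDF, gaussianPDFReal, NNReal.coe_one, mul_one, sub_zero]
  rw [mul_left_comm, ← Real.exp_add]
  congr 2; ring

lemma integral_exp_mul_sq_gaussianReal {t : ℝ} (ht : 2 * t < 1) :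
    ∫ x, rexp (t * x ^ 2) ∂(gaussianReal 0 1) = (1 - 2 * t) ^ (-(1 / 2) : ℝ) := by
  rw [integral_gaussianReal_eq_integral_smul one_ne_zero]
  have h : ∀ x : ℝ, gaussianPDFReal 0 1 x • rexp (t * x ^ 2)
      = (√(2 * π))⁻¹ * rexp (-(1 / 2 - t) * x ^ 2) := by
    intro x
    simp only [gaussianPDFReal, NNReal.coe_one, mul_one, sub_zero, smul_eq_mul]
    rw [mul_assoc, ← Real.exp_add]
    congr 2; ring
  simp_rw [h]
  have h1 : 0 < 1 - 2 * t := by linarith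
  rw [integral_const_mul, integral_gaussian, ← Real.sqrt_inv, ← Real.sqrt_mul (by positivity),
    Real.rpow_neg h1.le, ← Real.sqrt_eq_rpow, ← Real.sqrt_inv]
  congr 1
  have : 1 / 2 - t ≠ 0 := by linarith
  field_simp

/-- Under `N(0, B⁻¹)`, the quadratic form of `A` is distributed as a weighted sum of independent
chi-square variables, with weights the eigenvalues of `B^{-1/2} A B^{-1/2}`. -/
lemma exists_map_qf_eq {A B : Mat} (hB : B.PosDef) (hA : A.PosSemidef)
    (hAB : ∀ u : E, qf A u ≤ qf B u) :
    ∃ m : Fin p → ℝ, (∀ i, 0 ≤ m i) ∧ (∀ i, m i ≤ 1) ∧ ∑ i, m i = (A * B⁻¹).trace ∧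
      (multivariateGaussian 0 B⁻¹).map (qf A : E → ℝ) =
        (Measure.pi fun _ : Fin p => gaussianReal 0 1).map (fun x => ∑ i, m i * x i ^ 2) := by
  set s := CFC.sqrt B⁻¹ with hs
  have hsH : s.IsHermitian := isHermitian_sqrt_inv
  have hM : (s * A * s).PosSemidef := by
    have := hA.conjTranspose_mul_mul_same s
    rwa [hsH.eq] at this
  obtain ⟨M, hMdef⟩ : ∃ M, M = s * A * s := ⟨_, rfl⟩
  rw [← hMdef] at hM
  set b := hM.1.eigenvectorBasis
  have hb : ∀ i, toEuclideanCLM (𝕜 := ℝ) M (b i) = hM.1.eigenvalues i • b i := by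
    intro i
    have := hM.1.mulVec_eigenvectorBasis i
    exact (WithLp.ofLp_injective 2) (by simpa using this)
  have hqb : ∀ x : Fin p → ℝ, qf M (∑ i, x i • b i)
      = ∑ i, hM.1.eigenvalues i * x i ^ 2 := by
    intro x
    rw [qf_eq_inner, map_sum, sum_inner]
    refine Finset.sum_congr rfl fun i _ => ?_
    rw [inner_sum, Finset.sum_eq_single i]
    · simp [hb, inner_smul_left, inner_smul_right, b.orthonormal.1 i]; ring
    · intro j _ hj
      simp [hb, inner_smul_left, inner_smul_right, b.orthonormal.2 hj.symm]
    · simp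
  refine ⟨hM.1.eigenvalues, hM.eigenvalues_nonneg, fun i => ?_, ?_, ?_⟩
  -- Testing A ≤ B on B^{-1/2} b_i bounds the i-th eigenvalue by 1.
  · have h1 := hAB (toEuclideanCLM (𝕜 := ℝ) s (b i))
    rw [qf_conj hsH, qf_conj hsH, sqrt_inv_conj hB, qf_one, b.orthonormal.1 i, ← hMdef, qf_eq_inner,
      hb, inner_smul_right, real_inner_self_eq_norm_sq, b.orthonormal.1 i] at h1
    simpa using h1
  · have h1 := hM.1.trace_eq_sum_eigenvalues
    have h2 : M.trace = (A * B⁻¹).trace := by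
      rw [hMdef, Matrix.trace_mul_comm, ← mul_assoc, sqrt_inv_mul_self hB, Matrix.trace_mul_comm]
    rw [← h2]
    simpa using h1.symm
  · rw [multivariateGaussian, stdGaussian_eq_map_pi_orthonormalBasis b,
      Measure.map_map (by fun_prop) (by fun_prop), Measure.map_map (by fun_prop) (by fun_prop)]
    congr 1
    ext x
    simp only [Function.comp_apply, zero_add]
    rw [qf_conj hsH, ← hMdef, hqb]

/-- Chernoff bound for quadratic forms of Gaussian vectors. -/
lemma measureReal_sq_le_qf_le {A B : Mat} (hB : B.PosDef) (hA : A.PosSemidef)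
    (hAB : ∀ u : E, qf A u ≤ qf B u) {c y : ℝ} (hk : 0 < (A * B⁻¹).trace)
    (hc : c = min 1 (A * B⁻¹).trace) (hy : √(A * B⁻¹).trace ≤ y) :
    (multivariateGaussian 0 B⁻¹).real {u : E | y ^ 2 ≤ qf A u} ≤
      rexp (-((y - √(A * B⁻¹).trace) ^ 2 / (2 * c))) := by
  obtain ⟨m, hm0, hm1, hms, hmap⟩ := exists_map_qf_eq hB hA hAB
  set k := (A * B⁻¹).trace with hkdef
  have hc0 : 0 < c := by rw [hc]; exact lt_min one_pos hk
  have hmc : ∀ i, m i ≤ c := fun i => by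
    rw [hc]
    exact le_min (hm1 i) (hms ▸ Finset.single_le_sum (fun j _ => hm0 j) (Finset.mem_univ i))
  have hsk : 0 < √k := Real.sqrt_pos.2 hk
  have hy0 : 0 < y := hsk.trans_le hy
  have hky : k ≤ y ^ 2 := by
    rw [← Real.sq_sqrt hk.le]; gcongr
  -- This v, through 2tc = 1 - v, is the optimal Chernoff parameter when the m_i are replaced by k/c
  -- equal weights c.
  set v := k / y ^ 2 with hv
  have hv0 : 0 < v := by positivity
  have hv1 : v ≤ 1 := (div_le_one (by positivity)).2 hky
  set t := (1 - v) / (2 * c) with ht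
  have ht0 : 0 ≤ t := div_nonneg (by linarith) (by positivity)
  have htc : 2 * t * c = 1 - v := by rw [ht]; field_simp
  have htm : ∀ i, 2 * (t * m i) ≤ 1 - v := fun i => by
    rw [← htc, ← mul_assoc]; exact mul_le_mul_of_nonneg_left (hmc i) (by positivity)
  have hexp : ∀ x : Fin p → ℝ, rexp (t * ∑ i, m i * x i ^ 2)
      = ∏ i, rexp (t * m i * x i ^ 2) := by
    intro x
    rw [← Real.exp_sum, Finset.mul_sum]
    congr 1
    exact Finset.sum_congr rfl fun i _ => by ring
  have hlaw : ∀ S : Set ℝ, MeasurableSet S →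
      (multivariateGaussian 0 B⁻¹).real {u : E | qf A u ∈ S}
      = (Measure.pi fun _ : Fin p => gaussianReal 0 1).real {x | ∑ i, m i * x i ^ 2 ∈ S} := by
    intro S hS
    have := congrArg (fun μ => (μ S).toReal) hmap
    rwa [Measure.map_apply (by fun_prop) hS, Measure.map_apply (by fun_prop) hS] at this
  have h1 : (multivariateGaussian 0 B⁻¹).real {u : E | y ^ 2 ≤ qf A u} ≤
      rexp (-t * y ^ 2) * ∏ i, (1 - 2 * (t * m i)) ^ (-(1 / 2) : ℝ) := by
    rw [show {u : E | y ^ 2 ≤ qf A u} = {u : E | qf A u ∈ Set.Ici (y ^ 2)} from rfl,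
      hlaw _ measurableSet_Ici]
    refine (measure_ge_le_exp_mul_mgf (X := fun x : Fin p → ℝ => ∑ i, m i * x i ^ 2)
      (y ^ 2) ht0 ?_).trans_eq ?_
    · simp_rw [hexp]
      exact Integrable.fintype_prod (f := fun i x => rexp (t * m i * x ^ 2)) fun i =>
        integrable_exp_mul_sq_gaussianReal (by linarith [htm i])
    · rw [mgf]
      simp_rw [hexp]
      rw [integral_fintype_prod_eq_prod (f := fun i x => rexp (t * m i * x ^ 2))]
      congr 1
      exact Finset.prod_congr rfl fun i _ =>
        integral_exp_mul_sq_gaussianReal (by linarith [htm i])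
  have h2 : ∏ i, (1 - 2 * (t * m i)) ^ (-(1 / 2) : ℝ) ≤ v ^ (-(k / (2 * c))) := by
    have h3 : ∀ i, (1 - 2 * (t * m i)) ^ (-(1 / 2) : ℝ) ≤ v ^ (m i * (-(1 / (2 * c)))) := by
      intro i
      -- Bernoulli's inequality with exponent m_i/c ≤ 1 compares each factor with a power of v, so
      -- the product depends only on Σ m_i = k.
      have h4 := _root_.rpow_one_add_le_one_add_mul_self (s := -(2 * t * c)) (p := m i / c)
        (by linarith) (div_nonneg (hm0 i) hc0.le) ((div_le_one hc0).2 (hmc i))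
      have h5 : 1 + -(2 * t * c) = v := by linarith
      have h6 : 1 + m i / c * -(2 * t * c) = 1 - 2 * (t * m i) := by field_simp; ring
      rw [h5, h6] at h4
      calc (1 - 2 * (t * m i)) ^ (-(1 / 2) : ℝ) ≤ (v ^ (m i / c)) ^ (-(1 / 2) : ℝ) :=
            Real.rpow_le_rpow_of_nonpos (by positivity) h4 (by norm_num)
        _ = v ^ (m i * (-(1 / (2 * c)))) := by
            rw [← Real.rpow_mul hv0.le]; congr 1; field_simp
    calc _ ≤ ∏ i, v ^ (m i * (-(1 / (2 * c)))) :=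
          Finset.prod_le_prod (fun i _ => Real.rpow_nonneg (by linarith [htm i]) _) fun i _ => h3 i
      _ = v ^ (-(k / (2 * c))) := by
          rw [← Real.rpow_sum_of_pos hv0, ← Finset.sum_mul, hms]; congr 1; field_simp
  refine h1.trans ((mul_le_mul_of_nonneg_left h2 (Real.exp_pos _).le).trans ?_)
  rw [Real.rpow_def_of_pos hv0, ← Real.exp_add]
  apply Real.exp_le_exp.2
  have hlog : -Real.log v ≤ 2 * (y / √k - 1) := by
    have h7 : v = (y / √k) ^ (-2 : ℤ) := by
      rw [hv, _root_.zpow_neg, div_zpow, inv_div, zpow_ofNat, zpow_ofNat, Real.sq_sqrt hk.le]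
    rw [h7, Real.log_zpow]
    have := Real.log_le_sub_one_of_pos (div_pos hy0 hsk)
    push_cast; linarith
  have h8 : k * (y / √k) = √k * y := by
    nth_rewrite 1 [← Real.mul_self_sqrt hk.le]; field_simp
  have h9 : -t * y ^ 2 = (-y ^ 2 + k) / (2 * c) := by
    rw [ht, hv]; field_simp; ring
  have h10 : Real.log v * -(k / (2 * c)) ≤ (2 * (√k * y) - 2 * k) / (2 * c) := by
    have : Real.log v * -(k / (2 * c)) = (k * (-Real.log v)) / (2 * c) := by ring
    rw [this]
    gcongr
    calc k * -Real.log v ≤ k * (2 * (y / √k - 1)) := by gcongr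
      _ = 2 * (√k * y) - 2 * k := by rw [← h8]; ring
  calc _ ≤ (-y ^ 2 + k) / (2 * c) + (2 * (√k * y) - 2 * k) / (2 * c) := by rw [h9]; linarith
    _ = -((y - √k) ^ 2 / (2 * c)) := by
      rw [← add_div, ← neg_div]; congr 1
      have := Real.sq_sqrt hk.le
      linear_combination this

lemma trace_mul_inv_nonneg {A B : Mat} (hB : B.PosDef) (hA : A.PosSemidef)
    (hAB : ∀ u : E, qf A u ≤ qf B u) : 0 ≤ (A * B⁻¹).trace := by
  obtain ⟨m, hm0, -, hms, -⟩ := exists_map_qf_eq hB hA hAB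
  exact hms ▸ Finset.sum_nonneg fun i _ => hm0 i

lemma measure_qf_pos_eq_zero {A B : Mat} (hB : B.PosDef) (hA : A.PosSemidef)
    (hAB : ∀ u : E, qf A u ≤ qf B u) (hk : (A * B⁻¹).trace = 0) :
    multivariateGaussian 0 B⁻¹ {u : E | 0 < qf A u} = 0 := by
  obtain ⟨m, hm0, -, hms, hmap⟩ := exists_map_qf_eq hB hA hAB
  have hm : ∀ i, m i = 0 := fun i =>
    (Finset.sum_eq_zero_iff_of_nonneg fun i _ => hm0 i).1 (hms.trans hk) i (Finset.mem_univ i)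
  have := congrArg (fun μ => μ (Set.Ioi 0)) hmap
  rw [Measure.map_apply (by fun_prop) measurableSet_Ioi,
    Measure.map_apply (by fun_prop) measurableSet_Ioi] at this
  refine this.trans ?_
  simp [hm]

end Concentration

/-! ### Gaussian integration by parts along a linear field. -/

section IntegrationByParts

variable {p : ℕ}

local notation "E" => EuclideanSpace ℝ (Fin p)
local notation "Mat" => Matrix (Fin p) (Fin p) ℝ

lemma inner_inv_mul {A B : Mat} (hB : B.PosDef) (u v : E) :
    ⟪toEuclideanCLM (𝕜 := ℝ) B u, toEuclideanCLM (𝕜 := ℝ) (B⁻¹ * A) v⟫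
      = ⟪u, toEuclideanCLM (𝕜 := ℝ) A v⟫ := by
  rw [← inner_toEuclideanCLM_comm hB.1, ← mul_apply_eq_comp, ← map_mul, ← mul_assoc,
    Matrix.mul_nonsing_inv _ ((Matrix.isUnit_iff_isUnit_det _).1 hB.isUnit), one_mul]

lemma hasFDerivAt_exp_neg_qf {B : Mat} (hB : B.IsHermitian) (u : E) :
    HasFDerivAt (fun u : E => rexp (-(qf B u / 2)))
      (-(rexp (-(qf B u / 2)) • innerSL ℝ (toEuclideanCLM (𝕜 := ℝ) B u))) u := by
  have := ((hasFDerivAt_qf hB u).mul_const (1 / 2 : ℝ)).neg.exp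
  refine (this.congr_fderiv ?_).congr_of_eventuallyEq (Filter.Eventually.of_forall fun u => ?_)
  · ext v
    simp
    left; ring_nf
  · simp; ring

/-- Gaussian integration by parts along the linear vector field `u ↦ B⁻¹ A u`. -/
lemma integral_mul_qf_sub_trace {A B : Mat} (hB : B.PosDef) {F : E → ℝ} (hF : ContDiff ℝ 1 F)
    (hFc : HasCompactSupport F) :
    ∫ u, F u * (qf A u - (A * B⁻¹).trace) ∂(multivariateGaussian 0 B⁻¹) =
      ∫ u, fderiv ℝ F u (toEuclideanCLM (𝕜 := ℝ) (B⁻¹ * A) u) ∂(multivariateGaussian 0 B⁻¹) := by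
  set N := toEuclideanCLM (𝕜 := ℝ) (B⁻¹ * A) with hN
  set d : E → ℝ := fun u => rexp (-(qf B u / 2)) with hd
  set e : Fin p → E := fun i => EuclideanSpace.single i (1 : ℝ) with he
  have hdcont : Continuous d := by fun_prop
  have hFd : Continuous (fderiv ℝ F) := hF.continuous_fderiv one_ne_zero
  have hg : ∀ i u, HasFDerivAt (fun u : E => ⟪e i, N u⟫ * d u)
      (⟪e i, N u⟫ • (-(d u • innerSL ℝ (toEuclideanCLM (𝕜 := ℝ) B u)))
        + d u • ((innerSL ℝ (e i)).comp N)) u := fun i u =>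
    ((innerSL ℝ (e i)).comp N).hasFDerivAt.mul (hasFDerivAt_exp_neg_qf hB.1 u)
  have hsum : ∀ u : E, ∑ i, ⟪e i, u⟫ • e i = u := by
    intro u
    simpa [he] using (EuclideanSpace.basisFun (Fin p) ℝ).sum_repr' u
  -- One coordinate at a time for Lebesgue measure. Summed, the divergence of e^{-uᵀBu/2} N u is (k
  -- - q) e^{-uᵀBu/2}, because ⟨Bu, B⁻¹Au⟩ = q.
  have hcomp : ∀ i, ∫ u, (⟪e i, N u⟫ * d u) * fderiv ℝ F u (e i) =
      -∫ u, (-(⟪e i, N u⟫ * ⟪toEuclideanCLM (𝕜 := ℝ) B u, e i⟫) + ⟪e i, N (e i)⟫) * d u * F u := by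
    intro i
    have hfd : ∀ u, fderiv ℝ (fun u : E => ⟪e i, N u⟫ * d u) u (e i)
        = (-(⟪e i, N u⟫ * ⟪toEuclideanCLM (𝕜 := ℝ) B u, e i⟫) + ⟪e i, N (e i)⟫) * d u := by
      intro u
      rw [(hg i u).fderiv]
      simp
      ring
    simp_rw [← hfd]
    apply integral_mul_fderiv_eq_neg_fderiv_mul_of_integrable
    · simp_rw [hfd]
      exact Continuous.integrable_of_hasCompactSupport (by fun_prop) hFc.mul_left
    · exact Continuous.integrable_of_hasCompactSupport (by fun_prop)
        ((hFc.fderiv_apply ℝ (e i)).mul_left)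
    · exact Continuous.integrable_of_hasCompactSupport (by fun_prop) hFc.mul_left
    · exact fun u _ => (hg i u).differentiableAt
    · exact fun u _ => hF.differentiable one_ne_zero u
  have hI1 : ∀ i, Integrable (fun u => (⟪e i, N u⟫ * d u) * fderiv ℝ F u (e i)) := fun i =>
    Continuous.integrable_of_hasCompactSupport (by fun_prop)
      ((hFc.fderiv_apply ℝ (e i)).mul_left)
  have hI2 : ∀ i, Integrable (fun u => (-(⟪e i, N u⟫ * ⟪toEuclideanCLM (𝕜 := ℝ) B u, e i⟫)
      + ⟪e i, N (e i)⟫) * d u * F u) := fun i =>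
    Continuous.integrable_of_hasCompactSupport (by fun_prop) hFc.mul_left
  have key : ∫ u, d u * fderiv ℝ F u (N u) = ∫ u, d u * (F u * (qf A u - (A * B⁻¹).trace)) := by
    have h1 : ∀ u, d u * fderiv ℝ F u (N u)
        = ∑ i, (⟪e i, N u⟫ * d u) * fderiv ℝ F u (e i) := by
      intro u
      conv_lhs => rw [← hsum (N u), map_sum]
      rw [Finset.mul_sum]
      refine Finset.sum_congr rfl fun i _ => ?_
      rw [map_smul, smul_eq_mul]; ring
    have h2 : ∀ u, d u * (F u * (qf A u - (A * B⁻¹).trace))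
        = -∑ i, (-(⟪e i, N u⟫ * ⟪toEuclideanCLM (𝕜 := ℝ) B u, e i⟫)
      + ⟪e i, N (e i)⟫) * d u * F u := by
      intro u
      have h3 : ∑ i, ⟪e i, N u⟫ * ⟪toEuclideanCLM (𝕜 := ℝ) B u, e i⟫ = qf A u := by
        rw [qf_eq_inner, ← inner_inv_mul hB, ← hN]
        conv_rhs => rw [← hsum (N u), inner_sum]
        simp_rw [inner_smul_right]
      have h4 : ∑ i, ⟪e i, N (e i)⟫ = (A * B⁻¹).trace := by
        rw [Matrix.trace_mul_comm, Matrix.trace]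
        refine Finset.sum_congr rfl fun i _ => ?_
        rw [hN, inner_toEuclideanCLM]
        simp [he]
      rw [← Finset.sum_mul, ← Finset.sum_mul, Finset.sum_add_distrib, Finset.sum_neg_distrib, h3,
        h4]
      ring
    simp_rw [h1, h2]
    rw [integral_neg, integral_finsetSum _ fun i _ => hI1 i,
      integral_finsetSum _ fun i _ => hI2 i, ← Finset.sum_neg_distrib]
    exact Finset.sum_congr rfl fun i _ => hcomp i
  rw [multivariateGaussian_eq_tilted hB, integral_tilted, integral_tilted]
  simp only [sub_zero, smul_eq_mul, div_mul_eq_mul_div]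
  rw [integral_div, integral_div, key]

end IntegrationByParts

/-! ### Tangent bound for concave functions. -/

section Convexity

variable {F : Type*} [NormedAddCommGroup F] [NormedSpace ℝ F]

/-- A concave function lies below its tangents. -/
lemma _root_.ConcaveOn.le_add_fderiv {H : F → ℝ} (hH : ConcaveOn ℝ Set.univ H) {u : F}
    {H' : F →L[ℝ] ℝ} (hd : HasFDerivAt H H' u) (v : F) : H (u + v) ≤ H u + H' v := by
  have h1 : HasDerivAt (fun t : ℝ => H (u + t • v)) (H' v) 0 := hd.hasLineDerivAt v
  have h2 : Filter.Tendsto (fun t : ℝ => t⁻¹ • (H (u + t • v) - H u)) (𝓝[>] 0) (𝓝 (H' v)) := by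
    have := h1.tendsto_slope_zero_right
    simpa using this
  have h3 : H (u + v) - H u ≤ H' v := by
    refine ge_of_tendsto h2 ?_
    filter_upwards [Ioc_mem_nhdsGT (show (0 : ℝ) < 1 by norm_num)] with t ht
    have h4 := hH.2 (Set.mem_univ u) (Set.mem_univ (u + v)) (show 0 ≤ 1 - t by linarith [ht.2])
      ht.1.le (by ring)
    have h5 : (1 - t) • u + t • (u + v) = u + t • v := by module
    rw [h5, smul_eq_mul, smul_eq_mul] at h4
    rw [smul_eq_mul, inv_mul_eq_div, le_div_iff₀ ht.1]
    linarith
  linarith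

end Convexity

/-! ### The scalar test function and its key inequality. -/

section Scalar

/-- The `C¹` test function `(d + 1) eᵈ - 1 - 2 d` on `d ≥ 0`, extended by zero. -/
noncomputable def psi (d : ℝ) : ℝ := (max d 0 + 1) * rexp (max d 0) - 1 - 2 * max d 0

/-- The derivative of `psi`. -/
noncomputable def psiDeriv (d : ℝ) : ℝ := (max d 0 + 2) * rexp (max d 0) - 2

lemma psi_of_nonneg {d : ℝ} (hd : 0 ≤ d) : psi d = (d + 1) * rexp d - 1 - 2 * d := by
  rw [psi, max_eq_left hd]

lemma psiDeriv_of_nonneg {d : ℝ} (hd : 0 ≤ d) : psiDeriv d = (d + 2) * rexp d - 2 := by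
  rw [psiDeriv, max_eq_left hd]

lemma psi_of_nonpos {d : ℝ} (hd : d ≤ 0) : psi d = 0 := by
  simp [psi, max_eq_right hd]

lemma psiDeriv_of_nonpos {d : ℝ} (hd : d ≤ 0) : psiDeriv d = 0 := by
  simp [psiDeriv, max_eq_right hd]

lemma hasDerivAt_psi_formula (d : ℝ) :
    HasDerivAt (fun d => (d + 1) * rexp d - 1 - 2 * d) ((d + 2) * rexp d - 2) d := by
  have h := ((((hasDerivAt_id d).add_const 1).mul (Real.hasDerivAt_exp d)).sub_const 1).sub
    ((hasDerivAt_id d).const_mul 2)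
  refine h.congr_deriv ?_
  simp; ring

lemma hasDerivAt_psi (d : ℝ) : HasDerivAt psi (psiDeriv d) d := by
  rcases lt_trichotomy d 0 with hd | rfl | hd
  · rw [psiDeriv_of_nonpos hd.le]
    refine (hasDerivAt_const d (0 : ℝ)).congr_of_eventuallyEq ?_
    filter_upwards [Iio_mem_nhds hd] with x hx using psi_of_nonpos (le_of_lt hx)
  · rw [psiDeriv_of_nonpos le_rfl, ← hasDerivWithinAt_univ, ← Set.Iic_union_Ici (a := (0 : ℝ))]
    refine HasDerivWithinAt.union ?_ ?_
    · exact (hasDerivWithinAt_const (0 : ℝ) _ (0 : ℝ)).congr (fun x hx => psi_of_nonpos hx)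
        (psi_of_nonpos le_rfl)
    · have := (hasDerivAt_psi_formula 0).hasDerivWithinAt (s := Set.Ici 0)
      refine (this.congr (fun x hx => psi_of_nonneg hx) (psi_of_nonneg le_rfl)).congr_deriv ?_
      simp
  · rw [psiDeriv_of_nonneg hd.le]
    refine (hasDerivAt_psi_formula d).congr_of_eventuallyEq ?_
    filter_upwards [Ioi_mem_nhds hd] with x hx using psi_of_nonneg (le_of_lt hx)

@[fun_prop]
lemma continuous_psiDeriv : Continuous psiDeriv := by unfold psiDeriv; fun_prop

lemma contDiff_psi : ContDiff ℝ 1 psi := by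
  rw [contDiff_one_iff_deriv]
  refine ⟨fun d => (hasDerivAt_psi d).differentiableAt, ?_⟩
  rw [show deriv psi = psiDeriv from funext fun d => (hasDerivAt_psi d).deriv]
  fun_prop

@[fun_prop]
lemma continuous_psi : Continuous psi := contDiff_psi.continuous

lemma exp_sub_one_le {d : ℝ} : rexp d - 1 ≤ d * rexp d := by
  have h := Real.add_one_le_exp (-d)
  have h1 : rexp (-d) * rexp d = 1 := by rw [← Real.exp_add]; simp
  nlinarith [Real.exp_pos d]

lemma psi_nonneg (d : ℝ) : 0 ≤ psi d := by
  rcases le_total d 0 with hd | hd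
  · exact (psi_of_nonpos hd).ge
  · rw [psi_of_nonneg hd]
    nlinarith [Real.add_one_le_exp d]

lemma psiDeriv_nonneg (d : ℝ) : 0 ≤ psiDeriv d := by
  rcases le_total d 0 with hd | hd
  · exact (psiDeriv_of_nonpos hd).ge
  · rw [psiDeriv_of_nonneg hd]
    nlinarith [Real.add_one_le_exp d]

/-- Quadratic vanishing at 0 keeps ψ(δ)/q and ψ(δ)/q² bounded near q = 0, where δ is O(q). -/
lemma psi_le {d : ℝ} (hd : 0 ≤ d) : psi d ≤ 3 * d ^ 2 * rexp d := by
  rw [psi_of_nonneg hd]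
  have h1 : rexp d - 1 ≤ d * rexp d := exp_sub_one_le
  have h2 := mul_le_mul_of_nonneg_left h1 hd
  nlinarith [Real.add_one_le_exp d]

lemma psiDeriv_le {d : ℝ} (hd : 0 ≤ d) : psiDeriv d ≤ 3 * d * rexp d := by
  rw [psiDeriv_of_nonneg hd]
  linarith [exp_sub_one_le (d := d)]

lemma two_sub_mul_exp_le {d : ℝ} (hd : 0 ≤ d) : 0 ≤ (d - 2) * rexp d + d + 2 := by
  have hderiv : ∀ x : ℝ, HasDerivAt (fun d => (d - 2) * rexp d + d + 2) ((x - 1) * rexp x + 1) x := by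
    intro x
    have h := ((((hasDerivAt_id x).sub_const 2).mul (Real.hasDerivAt_exp x)).add
      (hasDerivAt_id x)).add_const 2
    refine h.congr_deriv ?_
    simp; ring
  have hmono : Monotone (fun d => (d - 2) * rexp d + d + 2) :=
    monotone_of_deriv_nonneg (fun x => (hderiv x).differentiableAt) fun x => by
      rw [(hderiv x).deriv]
      linarith [exp_sub_one_le (d := x)]
  have := hmono hd
  simpa using this

lemma klFun_exp (d : ℝ) : klFun (rexp d) = (d - 1) * rexp d + 1 := by
  rw [klFun_apply, Real.log_exp]; ring

lemma klFun_exp_le_of_nonpos {d : ℝ} (hd : d ≤ 0) : klFun (rexp d) ≤ -d := by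
  rw [klFun_exp]
  have := Real.add_one_le_exp d
  nlinarith [Real.exp_pos d]

/-- The pointwise inequality behind the local bound. -/
lemma psi_test_inequality {d q k m ω : ℝ} (hd : 0 < d) (hω3 : ω ≤ 1 / 3) (hω0 : 0 ≤ ω)
    (hdq : d ≤ ω * q / 2) (hωk : ω * k ≤ 2 / 3) (hm0 : 0 ≤ m) (hm1 : m ≤ 1) :
    q * ((1 - ω) / 2 * klFun (rexp d) - 2 * d) ≤
      psi d * (q - k + 2 * m) - psiDeriv d * (d + q * (ω + (1 - ω) * m) / 2) := by
  have hω : 0 < ω := by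
    rcases hω0.eq_or_lt with h | h
    · rw [← h] at hdq; linarith
    · exact h
  have hq : 0 < q := by
    by_contra h
    have : ω * q ≤ 0 := mul_nonpos_of_nonneg_of_nonpos hω0 (not_lt.1 h)
    linarith
  have hψ0 := psi_nonneg d
  have hψ'0 := psiDeriv_nonneg d
  have e1 := Real.add_one_le_exp d
  have hconv : psi d ≤ d * psiDeriv d := by
    rw [psi_of_nonneg hd.le, psiDeriv_of_nonneg hd.le]
    have := exp_sub_one_le (d := d)
    nlinarith [mul_pos hd hd, Real.exp_pos d]
  -- This identity explains the formula for ψ: after the bounds on k and d are inserted, the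
  -- remainder is a multiple of (d - 2)e^d + d + 2, with a nonnegative factor exactly when ω ≤ 1/3.
  have hid : psi d * (d - 1 / 3 + ω) - psiDeriv d * d * (1 + ω) / 2
      - d * ((1 - ω) / 2 * klFun (rexp d) - 2 * d)
      = (1 - 3 * ω) / 6 * ((d - 2) * rexp d + d + 2) := by
    rw [psi_of_nonneg hd.le, psiDeriv_of_nonneg hd.le, klFun_exp]; ring
  have hpos := mul_nonneg (show 0 ≤ (1 - 3 * ω) / 6 by linarith) (two_sub_mul_exp_le hd.le)
  have hk1 : (k - 2) * d ≤ q * (1 / 3 - ω) := by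
    refine le_of_mul_le_mul_left ?_ hω
    calc ω * ((k - 2) * d) ≤ (2 / 3 - 2 * ω) * d := by nlinarith
      _ ≤ (2 / 3 - 2 * ω) * (ω * q / 2) := mul_le_mul_of_nonneg_left hdq (by linarith)
      _ = ω * (q * (1 / 3 - ω)) := by ring
  have hk0 : k * d ≤ q / 3 := by
    refine le_of_mul_le_mul_left ?_ hω
    nlinarith
  set L := (1 - ω) / 2 * klFun (rexp d) - 2 * d with hL
  -- The claim is affine in m, so only the endpoints m = 1 (here) and m = 0 (`h0`) need proof.
  have h1 : q * L ≤ psi d * (q - k + 2) - psiDeriv d * (d + q / 2) := by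
    refine le_of_mul_le_mul_left ?_ hd
    have a1 : psi d * ((k - 2) * d) ≤ psi d * (q * (1 / 3 - ω)) :=
      mul_le_mul_of_nonneg_left hk1 hψ0
    have a2 : psiDeriv d * d * d ≤ psiDeriv d * d * (ω * q / 2) :=
      mul_le_mul_of_nonneg_left hdq (by positivity)
    have a3 : 0 ≤ q * (psi d * (d - 1 / 3 + ω) - psiDeriv d * d * (1 + ω) / 2 - d * L) :=
      mul_nonneg hq.le (by rw [hid]; exact hpos)
    nlinarith
  have h0 : q * L ≤ psi d * (q - k) - psiDeriv d * (d + q * ω / 2) := by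
    refine le_of_mul_le_mul_left ?_ hd
    have a1 : psi d * (k * d) ≤ psi d * (q / 3) := mul_le_mul_of_nonneg_left hk0 hψ0
    have a2 : psiDeriv d * d * d ≤ psiDeriv d * d * (ω * q / 2) :=
      mul_le_mul_of_nonneg_left hdq (by positivity)
    have a3 : 0 ≤ q * (psi d * (d - 1 / 3 + ω) - psiDeriv d * d * (1 + ω) / 2 - d * L) :=
      mul_nonneg hq.le (by rw [hid]; exact hpos)
    have a4 : ω * psi d ≤ (1 - ω) / 2 * (d * psiDeriv d) :=
      mul_le_mul (by linarith) hconv hψ0 (by linarith)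
    have a5 := mul_le_mul_of_nonneg_left a4 hq.le
    nlinarith
  nlinarith [mul_le_mul_of_nonneg_left h1 hm0, mul_le_mul_of_nonneg_left h0 (sub_nonneg.2 hm1)]

end Scalar

/-! ### Integration by parts applied to ψ(δ)/(q + η). -/

section LocalBound

variable {p : ℕ}

local notation "E" => EuclideanSpace ℝ (Fin p)
local notation "Mat" => Matrix (Fin p) (Fin p) ℝ

lemma qf_inv_mul_le {A B : Mat} (hB : B.PosDef) (hAB : ∀ u : E, qf A u ≤ qf B u) (u : E) :
    qf A (toEuclideanCLM (𝕜 := ℝ) (B⁻¹ * A) u) ≤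
      ⟪toEuclideanCLM (𝕜 := ℝ) A u, toEuclideanCLM (𝕜 := ℝ) (B⁻¹ * A) u⟫ := by
  refine (hAB _).trans_eq ?_
  rw [qf_eq_inner, inner_toEuclideanCLM_comm hB.1, inner_inv_mul hB, real_inner_comm]

lemma inner_mul_inv_mul_nonneg {A B : Mat} (hB : B.PosDef) (hA : A.PosSemidef)
    (hAB : ∀ u : E, qf A u ≤ qf B u) (u : E) :
    0 ≤ ⟪toEuclideanCLM (𝕜 := ℝ) A u, toEuclideanCLM (𝕜 := ℝ) (B⁻¹ * A) u⟫ :=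
  (qf_nonneg hA _).trans (qf_inv_mul_le hB hAB u)

/-- With w = B⁻¹Au and s = ⟨Au, w⟩, Cauchy–Schwarz for A gives s² ≤ q(u) q(w) ≤ q(u) s, and s
cancels when positive. -/
lemma inner_mul_inv_mul_le {A B : Mat} (hB : B.PosDef) (hA : A.PosSemidef)
    (hAB : ∀ u : E, qf A u ≤ qf B u) (u : E) :
    ⟪toEuclideanCLM (𝕜 := ℝ) A u, toEuclideanCLM (𝕜 := ℝ) (B⁻¹ * A) u⟫ ≤ qf A u := by
  set s := ⟪toEuclideanCLM (𝕜 := ℝ) A u, toEuclideanCLM (𝕜 := ℝ) (B⁻¹ * A) u⟫ with hs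
  have h1 := inner_toEuclideanCLM_sq_le hA u (toEuclideanCLM (𝕜 := ℝ) (B⁻¹ * A) u)
  have h2 := qf_inv_mul_le hB hAB u
  have h3 := inner_mul_inv_mul_nonneg hB hA hAB u
  rw [← hs] at h1 h2 h3
  have h4 := mul_le_mul_of_nonneg_left h2 (qf_nonneg hA u)
  rcases h3.eq_or_lt with h | h
  · rw [← h]; exact qf_nonneg hA u
  · nlinarith

variable {A B : Matrix (Fin p) (Fin p) ℝ} {δ : EuclideanSpace ℝ (Fin p) → ℝ} {ω ρ : ℝ}

/-- Semi-concavity controls the derivative of the remainder along `u ↦ B⁻¹ A u`. -/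
lemma fderiv_inv_mul_le (hB : B.PosDef) (hA : A.PosSemidef) (hAB : ∀ u : E, qf A u ≤ qf B u)
    (hδ : Differentiable ℝ δ) (hH : ConcaveOn ℝ Set.univ fun u => δ u - qf A u / 2)
    (hω : 0 ≤ ω) (hloc : ∀ u, qf A u ≤ ρ → |δ u| ≤ ω * qf A u / 2) {u : E} (hu : qf A u ≤ ρ) :
    fderiv ℝ δ u (toEuclideanCLM (𝕜 := ℝ) (B⁻¹ * A) u) ≤ δ u + (ω * qf A u + (1 - ω) *
      ⟪toEuclideanCLM (𝕜 := ℝ) A u, toEuclideanCLM (𝕜 := ℝ) (B⁻¹ * A) u⟫) / 2 := by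
  set w := toEuclideanCLM (𝕜 := ℝ) (B⁻¹ * A) u with hw
  set s := ⟪toEuclideanCLM (𝕜 := ℝ) A u, w⟫ with hs
  have h1 : qf A w ≤ s := qf_inv_mul_le hB hAB u
  have h2 : s ≤ qf A u := inner_mul_inv_mul_le hB hA hAB u
  have h3 : 0 ≤ qf A w := qf_nonneg hA w
  have hd : HasFDerivAt (fun u => δ u - qf A u / 2)
      (fderiv ℝ δ u - (1 / 2 : ℝ) • ((2 : ℝ) • innerSL ℝ (toEuclideanCLM (𝕜 := ℝ) A u))) u := by
    have := (hδ u).hasFDerivAt.sub ((hasFDerivAt_qf hA.1 u).const_mul (1 / 2 : ℝ))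
    refine this.congr_of_eventuallyEq (Eventually.of_forall fun x => ?_)
    simp [div_eq_inv_mul]
  -- The tangent at u is compared with the value at u - w. Since q(u - w) = q(u) - 2s + q(w) ≤ q(u),
  -- that point stays in the region where δ ≥ -ωq/2.
  have h4 := hH.le_add_fderiv hd (-w)
  have h5 : qf A (u + -w) = qf A u - 2 * s + qf A w := by
    rw [← sub_eq_add_neg, qf_sub hA.1]
  have h6 : (fderiv ℝ δ u - (1 / 2 : ℝ) • ((2 : ℝ) • innerSL ℝ (toEuclideanCLM (𝕜 := ℝ) A u))) (-w)
      = -fderiv ℝ δ u w + s := by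
    simp [hs]
  have h7 := hloc (u + -w) (by rw [h5]; linarith)
  have h8 := (abs_le.1 h7).1
  rw [h5] at h4 h8
  rw [h6] at h4
  nlinarith

variable (A B δ) in
/-- The integrand produced by integrating `psi (δ u) / qf A u` by parts. -/
noncomputable def testIntegrand (η : ℝ) (u : EuclideanSpace ℝ (Fin p)) : ℝ :=
  psi (δ u) / (qf A u + η) * (qf A u - (A * B⁻¹).trace)
    + 2 * (psi (δ u) / (qf A u + η) ^ 2 *
      ⟪toEuclideanCLM (𝕜 := ℝ) A u, toEuclideanCLM (𝕜 := ℝ) (B⁻¹ * A) u⟫)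
    - psiDeriv (δ u) / (qf A u + η) * fderiv ℝ δ u (toEuclideanCLM (𝕜 := ℝ) (B⁻¹ * A) u)

lemma continuous_testIntegrand (hA : A.PosSemidef) (hδ : ContDiff ℝ 1 δ) {η : ℝ} (hη : 0 < η) :
    Continuous (testIntegrand A B δ η) := by
  have h1 : Continuous (fderiv ℝ δ) := hδ.continuous_fderiv one_ne_zero
  have h2 : ∀ u, qf A u + η ≠ 0 := fun u => by linarith [qf_nonneg hA u]
  have h3 := hδ.continuous
  unfold testIntegrand
  fun_prop (disch := simp [h2])

/-- Integration by parts for X ψ(δ)/(q + η) leaves exactly the integral of ψ(δ)/(q + η) times the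
derivative of X along the field, which is nonpositive. The shift η avoids dividing by zero where q
vanishes. -/
lemma integral_mul_testIntegrand_le_of_pos (hB : B.PosDef) (hA : A.PosSemidef)
    (hδ : ContDiff ℝ 1 δ) {X : E → ℝ} (hX : ContDiff ℝ 1 X) (hXc : HasCompactSupport X)
    (hXd : ∀ u, fderiv ℝ X u (toEuclideanCLM (𝕜 := ℝ) (B⁻¹ * A) u) ≤ 0) {η : ℝ} (hη : 0 < η) :
    ∫ u, X u * testIntegrand A B δ η u ∂(multivariateGaussian 0 B⁻¹) ≤ 0 := by
  have h2 : ∀ u, 0 < qf A u + η := fun u => by linarith [qf_nonneg hA u]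
  set G : E → ℝ := fun u => psi (δ u) / (qf A u + η) with hG
  have hGc : ContDiff ℝ 1 G :=
    (contDiff_psi.comp hδ).div ((contDiff_qf A).add contDiff_const) fun u => (h2 u).ne'
  have hF : ContDiff ℝ 1 (fun u => X u * G u) := hX.mul hGc
  have hFc : HasCompactSupport (fun u => X u * G u) := hXc.mul_right
  have hIBP := integral_mul_qf_sub_trace (A := A) hB hF hFc
  set N := toEuclideanCLM (𝕜 := ℝ) (B⁻¹ * A) with hN
  have hfd : ∀ u, fderiv ℝ (fun u => X u * G u) u (N u) = G u * fderiv ℝ X u (N u) +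
      X u * (psiDeriv (δ u) / (qf A u + η) * fderiv ℝ δ u (N u)
        - 2 * (psi (δ u) / (qf A u + η) ^ 2 * ⟪toEuclideanCLM (𝕜 := ℝ) A u, N u⟫)) := by
    intro u
    have hd1 := (hX.differentiable one_ne_zero u).hasFDerivAt
    have hd2 := (hδ.differentiable one_ne_zero u).hasFDerivAt
    have hd3 := (hasDerivAt_psi (δ u)).comp_hasFDerivAt u hd2
    have hd4 := (hasDerivAt_inv (h2 u).ne').comp_hasFDerivAt u
      ((hasFDerivAt_qf hA.1 u).add_const η)
    have hd5 : HasFDerivAt G _ u := hd3.mul hd4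
    have hd6 : HasFDerivAt (fun u => X u * G u) _ u := hd1.mul hd5
    rw [hd6.fderiv]
    simp only [_root_.add_apply, _root_.smul_apply, smul_eq_mul, Function.comp_apply,
      innerSL_apply_apply, hG]
    field_simp
    ring
  have hfdc : Continuous (fderiv ℝ (fun u => X u * G u)) := hF.continuous_fderiv one_ne_zero
  have hFcont := hF.continuous
  have hI1 : Integrable (fun u => X u * G u * (qf A u - (A * B⁻¹).trace))
      (multivariateGaussian 0 B⁻¹) :=
    Continuous.integrable_of_hasCompactSupport (by fun_prop) hFc.mul_right
  have hI2 : Integrable (fun u => fderiv ℝ (fun u => X u * G u) u (N u))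
      (multivariateGaussian 0 B⁻¹) := by
    refine Continuous.integrable_of_hasCompactSupport (by fun_prop) ?_
    refine (hFc.fderiv ℝ).mono fun u hu => ?_
    contrapose! hu
    simp only [Function.mem_support, not_not] at hu ⊢
    simp [hu]
  have hI3 : Integrable (fun u => X u * testIntegrand A B δ η u) (multivariateGaussian 0 B⁻¹) :=
    Continuous.integrable_of_hasCompactSupport
      (hX.continuous.mul (continuous_testIntegrand hA hδ hη)) hXc.mul_right
  calc _ ≤ ∫ u, (X u * G u * (qf A u - (A * B⁻¹).trace)
        - fderiv ℝ (fun u => X u * G u) u (N u)) ∂(multivariateGaussian 0 B⁻¹) := by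
        refine integral_mono hI3 (hI1.sub hI2) fun u => ?_
        have h3 : G u * fderiv ℝ X u (N u) ≤ 0 :=
          mul_nonpos_of_nonneg_of_nonpos (div_nonneg (psi_nonneg _) (h2 u).le) (hXd u)
        change X u * testIntegrand A B δ η u ≤ X u * G u * (qf A u - (A * B⁻¹).trace)
          - fderiv ℝ (fun u => X u * G u) u (N u)
        rw [hfd u, testIntegrand, ← hN]
        linarith
    _ = 0 := by rw [integral_sub hI1 hI2, hIBP, sub_self]

/-- The bound is uniform in η and serves as the dominating function for η → 0. It rests on ψ(δ) =
O(δ²), ψ'(δ) = O(δ) with a factor e^δ, and δ ≤ q + η. -/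
lemma abs_testIntegrand_le (hB : B.PosDef) (hA : A.PosSemidef)
    (hAB : ∀ u : E, qf A u ≤ qf B u) (hω3 : ω ≤ 1 / 3)
    (hloc : ∀ u, qf A u ≤ ρ → |δ u| ≤ ω * qf A u / 2) {η : ℝ} (hη : 0 ≤ η) {u : E}
    (hu : qf A u ≤ ρ) :
    |testIntegrand A B δ η u| ≤ 3 * rexp (δ u) * (|δ u| * |qf A u - (A * B⁻¹).trace|
      + 2 * qf A u + |fderiv ℝ δ u (toEuclideanCLM (𝕜 := ℝ) (B⁻¹ * A) u)|) := by
  have hq := qf_nonneg hA u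
  have hs0 := inner_mul_inv_mul_nonneg hB hA hAB u
  have hs1 := inner_mul_inv_mul_le hB hA hAB u
  unfold testIntegrand
  set s := ⟪toEuclideanCLM (𝕜 := ℝ) A u, toEuclideanCLM (𝕜 := ℝ) (B⁻¹ * A) u⟫
  set D := fderiv ℝ δ u (toEuclideanCLM (𝕜 := ℝ) (B⁻¹ * A) u)
  set k := (A * B⁻¹).trace
  rcases le_or_gt (δ u) 0 with hd | hd
  · rw [psi_of_nonpos hd, psiDeriv_of_nonpos hd]
    simp only [zero_div, zero_mul, mul_zero, add_zero, sub_zero, abs_zero]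
    positivity
  · have h1 : δ u ≤ ω * qf A u / 2 := (le_abs_self _).trans (hloc u hu)
    have h2 : δ u ≤ qf A u + η := by nlinarith
    have hQ : 0 < qf A u + η := hd.trans_le h2
    set Q := qf A u + η
    have p0 := psi_nonneg (δ u)
    have p1 := psi_le hd.le
    have p2 := psiDeriv_nonneg (δ u)
    have p3 := psiDeriv_le hd.le
    have e0 := Real.exp_pos (δ u)
    have a1 : psi (δ u) / Q ≤ 3 * rexp (δ u) * δ u := by
      rw [div_le_iff₀ hQ]
      calc psi (δ u) ≤ 3 * δ u ^ 2 * rexp (δ u) := p1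
        _ = 3 * rexp (δ u) * δ u * δ u := by ring
        _ ≤ _ := by gcongr
    have a2 : psi (δ u) / Q ^ 2 ≤ 3 * rexp (δ u) := by
      rw [div_le_iff₀ (by positivity)]
      calc psi (δ u) ≤ 3 * δ u ^ 2 * rexp (δ u) := p1
        _ = 3 * rexp (δ u) * δ u ^ 2 := by ring
        _ ≤ _ := by gcongr
    have a3 : psiDeriv (δ u) / Q ≤ 3 * rexp (δ u) := by
      rw [div_le_iff₀ hQ]
      calc psiDeriv (δ u) ≤ 3 * δ u * rexp (δ u) := p3
        _ = 3 * rexp (δ u) * δ u := by ring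
        _ ≤ _ := by gcongr
    have b1 : |psi (δ u) / Q * (qf A u - k)| ≤ 3 * rexp (δ u) * (|δ u| * |qf A u - k|) := by
      rw [abs_mul, abs_of_nonneg (div_nonneg p0 hQ.le), abs_of_pos hd, ← mul_assoc]
      gcongr
    have b2 : |2 * (psi (δ u) / Q ^ 2 * s)| ≤ 3 * rexp (δ u) * (2 * qf A u) := by
      rw [abs_of_nonneg (by positivity)]
      calc 2 * (psi (δ u) / Q ^ 2 * s) ≤ 2 * (3 * rexp (δ u) * qf A u) := by gcongr
        _ = _ := by ring
    have b3 : |psiDeriv (δ u) / Q * D| ≤ 3 * rexp (δ u) * |D| := by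
      rw [abs_mul, abs_of_nonneg (div_nonneg p2 hQ.le)]
      gcongr
    calc _ ≤ |psi (δ u) / Q * (qf A u - k)| + |2 * (psi (δ u) / Q ^ 2 * s)|
          + |psiDeriv (δ u) / Q * D| := (abs_sub _ _).trans (add_le_add_left (abs_add_le _ _) _)
      _ ≤ _ := by linarith

end LocalBound

/-! ### The limit η → 0 and the bound on the local region. -/

section LocalBoundLimit

variable {p : ℕ} {A B : Matrix (Fin p) (Fin p) ℝ} {δ : EuclideanSpace ℝ (Fin p) → ℝ} {ω ρ : ℝ}

local notation "E" => EuclideanSpace ℝ (Fin p)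

lemma tendsto_testIntegrand (hA : A.PosSemidef)
    (hloc : ∀ u, qf A u ≤ ρ → |δ u| ≤ ω * qf A u / 2) {u : E} (hu : qf A u ≤ ρ) :
    Tendsto (fun n : ℕ => testIntegrand A B δ (1 / ((n : ℝ) + 1)) u) atTop
      (𝓝 (testIntegrand A B δ 0 u)) := by
  rcases (qf_nonneg hA u).eq_or_lt with hq | hq
  -- Where q = 0 the numerators ψ(δ) and ψ'(δ) vanish, so division by zero at η = 0 does no harm.
  · have h0 : δ u ≤ 0 := by
      have := (le_abs_self _).trans (hloc u hu)
      rwa [← hq, mul_zero, zero_div] at this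
    simp [testIntegrand, psi_of_nonpos h0, psiDeriv_of_nonpos h0]
  · have h1 : ContinuousAt (fun η => testIntegrand A B δ η u) 0 := by
      unfold testIntegrand
      have h2 : qf A u + 0 ≠ 0 := by linarith
      fun_prop (disch := simp [hq.ne'])
    exact h1.tendsto.comp tendsto_one_div_add_atTop_nhds_zero_nat

variable (hB : B.PosDef) (hA : A.PosSemidef) (hAB : ∀ u : EuclideanSpace ℝ (Fin p), qf A u ≤ qf B u)
  (hδ : ContDiff ℝ 1 δ) (hω3 : ω ≤ 1 / 3)
  (hloc : ∀ u, qf A u ≤ ρ → |δ u| ≤ ω * qf A u / 2)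

include hB hA hAB hδ hω3 hloc

lemma integral_mul_testIntegrand_le {X : E → ℝ} (hX : ContDiff ℝ 1 X) (hXc : HasCompactSupport X)
    (hXd : ∀ u, fderiv ℝ X u (toEuclideanCLM (𝕜 := ℝ) (B⁻¹ * A) u) ≤ 0)
    (hXρ : ∀ u, X u ≠ 0 → qf A u ≤ ρ) :
    Integrable (fun u => X u * testIntegrand A B δ 0 u) (multivariateGaussian 0 B⁻¹) ∧
      ∫ u, X u * testIntegrand A B δ 0 u ∂(multivariateGaussian 0 B⁻¹) ≤ 0 := by
  have hδc := hδ.continuous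
  have hδ' : Continuous (fderiv ℝ δ) := hδ.continuous_fderiv one_ne_zero
  have hXcont := hX.continuous
  set D : E → ℝ := fun u => |X u| * (3 * rexp (δ u) * (|δ u| * |qf A u - (A * B⁻¹).trace|
      + 2 * qf A u + |fderiv ℝ δ u (toEuclideanCLM (𝕜 := ℝ) (B⁻¹ * A) u)|)) with hD
  have hDi : Integrable D (multivariateGaussian 0 B⁻¹) :=
    Continuous.integrable_of_hasCompactSupport (by fun_prop) hXc.norm.mul_right
  have hbound : ∀ η : ℝ, 0 ≤ η → ∀ u, ‖X u * testIntegrand A B δ η u‖ ≤ D u := by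
    intro η hη u
    rw [Real.norm_eq_abs, abs_mul]
    by_cases h : X u = 0
    · simp [hD, h]
    · exact mul_le_mul_of_nonneg_left (abs_testIntegrand_le hB hA hAB hω3 hloc hη (hXρ u h))
        (abs_nonneg _)
  have hlim : ∀ u, Tendsto (fun n : ℕ => X u * testIntegrand A B δ (1 / ((n : ℝ) + 1)) u) atTop
      (𝓝 (X u * testIntegrand A B δ 0 u)) := by
    intro u
    by_cases h : X u = 0
    · simp [h]
    · exact (tendsto_testIntegrand hA hloc (hXρ u h)).const_mul _
  have hmeas : ∀ n : ℕ, AEStronglyMeasurable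
      (fun u => X u * testIntegrand A B δ (1 / ((n : ℝ) + 1)) u) (multivariateGaussian 0 B⁻¹) :=
    fun n => (hXcont.mul (continuous_testIntegrand hA hδ (by positivity))).aestronglyMeasurable
  have hmeas0 := aestronglyMeasurable_of_tendsto_ae atTop hmeas (ae_of_all _ hlim)
  refine ⟨hDi.mono' hmeas0 (ae_of_all _ (hbound 0 le_rfl)), ?_⟩
  refine le_of_tendsto (tendsto_integral_of_dominated_convergence D hmeas hDi
    (fun n => ae_of_all _ (hbound _ (by positivity))) (ae_of_all _ hlim)) (Eventually.of_forall ?_)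
  exact fun n => integral_mul_testIntegrand_le_of_pos hB hA hδ hX hXc hXd (by positivity)

lemma klFun_exp_le_testIntegrand (hω0 : 0 ≤ ω) (hωk : ω * (A * B⁻¹).trace ≤ 2 / 3)
    (hH : ConcaveOn ℝ Set.univ fun u => δ u - qf A u / 2) {u : E} (hu : qf A u ≤ ρ) :
    klFun (rexp (δ u)) ≤ 2 / (1 - ω) * testIntegrand A B δ 0 u + 4 / (1 - ω) * |δ u| := by
  have h1ω : 0 < 1 - ω := by linarith
  rcases le_or_gt (δ u) 0 with hd | hd
  · have h1 : testIntegrand A B δ 0 u = 0 := by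
      simp [testIntegrand, psi_of_nonpos hd, psiDeriv_of_nonpos hd]
    rw [h1, mul_zero, zero_add, abs_of_nonpos hd]
    refine (klFun_exp_le_of_nonpos hd).trans ?_
    refine le_mul_of_one_le_left (by linarith) ?_
    rw [le_div_iff₀ h1ω]; linarith
  · have hdq : δ u ≤ ω * qf A u / 2 := (le_abs_self _).trans (hloc u hu)
    have hq : 0 < qf A u := by
      refine (qf_nonneg hA u).lt_of_ne fun h => ?_
      rw [← h] at hdq; linarith
    have hs0 := inner_mul_inv_mul_nonneg hB hA hAB u
    have hs1 := inner_mul_inv_mul_le hB hA hAB u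
    have hD := fderiv_inv_mul_le hB hA hAB (hδ.differentiable one_ne_zero) hH hω0 hloc hu
    rw [testIntegrand]
    set s := ⟪toEuclideanCLM (𝕜 := ℝ) A u, toEuclideanCLM (𝕜 := ℝ) (B⁻¹ * A) u⟫
    set D := fderiv ℝ δ u (toEuclideanCLM (𝕜 := ℝ) (B⁻¹ * A) u)
    set k := (A * B⁻¹).trace
    set q := qf A u
    -- The ratio m = s/q lies in [0, 1] and is otherwise uncontrolled, which is why the scalar
    -- inequality covers that whole range.
    have h1 := psi_test_inequality (m := s / q) hd hω3 hω0 hdq hωk (by positivity)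
      ((div_le_one hq).2 hs1)
    have h2 : psiDeriv (δ u) * D ≤ psiDeriv (δ u) * (δ u + q * (ω + (1 - ω) * (s / q)) / 2) := by
      refine mul_le_mul_of_nonneg_left (hD.trans_eq ?_) (psiDeriv_nonneg _)
      field_simp
    have h3 : psi (δ u) / (q + 0) * (q - k) + 2 * (psi (δ u) / (q + 0) ^ 2 * s)
        - psiDeriv (δ u) / (q + 0) * D
        = (psi (δ u) * (q - k + 2 * (s / q)) - psiDeriv (δ u) * D) / q := by
      rw [add_zero]; field_simp
    rw [h3, abs_of_pos hd]
    have h4 : (1 - ω) / 2 * klFun (rexp (δ u)) - 2 * δ u ≤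
        (psi (δ u) * (q - k + 2 * (s / q)) - psiDeriv (δ u) * D) / q := by
      rw [le_div_iff₀ hq]; linarith
    have h5 := mul_le_mul_of_nonneg_left h4 (show 0 ≤ 2 / (1 - ω) by positivity)
    have h6 : 2 / (1 - ω) * ((1 - ω) / 2 * klFun (rexp (δ u)) - 2 * δ u)
        = klFun (rexp (δ u)) - 4 / (1 - ω) * δ u := by
      field_simp; ring
    linarith

lemma integral_mul_klFun_exp_le (hω0 : 0 ≤ ω) (hωk : ω * (A * B⁻¹).trace ≤ 2 / 3)
    (hH : ConcaveOn ℝ Set.univ fun u => δ u - qf A u / 2) {g : E → ℝ}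
    (hg : Integrable g (multivariateGaussian 0 B⁻¹)) (hg0 : ∀ u, 0 ≤ g u)
    (hδg : ∀ u, qf A u ≤ ρ → |δ u| ≤ g u)
    {X : E → ℝ} (hX : ContDiff ℝ 1 X) (hXc : HasCompactSupport X)
    (hXd : ∀ u, fderiv ℝ X u (toEuclideanCLM (𝕜 := ℝ) (B⁻¹ * A) u) ≤ 0)
    (hXρ : ∀ u, X u ≠ 0 → qf A u ≤ ρ) (hX0 : ∀ u, 0 ≤ X u) (hX1 : ∀ u, X u ≤ 1) :
    ∫ u, X u * klFun (rexp (δ u)) ∂(multivariateGaussian 0 B⁻¹) ≤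
      4 / (1 - ω) * ∫ u, g u ∂(multivariateGaussian 0 B⁻¹) := by
  have h1ω : 0 < 1 - ω := by linarith
  have hδc := hδ.continuous
  have hXcont := hX.continuous
  have hk := continuous_klFun
  obtain ⟨hI, hle⟩ := integral_mul_testIntegrand_le hB hA hAB hδ hω3 hloc hX hXc hXd hXρ
  have hI1 : Integrable (fun u => X u * klFun (rexp (δ u))) (multivariateGaussian 0 B⁻¹) :=
    Continuous.integrable_of_hasCompactSupport (by fun_prop) hXc.mul_right
  calc ∫ u, X u * klFun (rexp (δ u)) ∂(multivariateGaussian 0 B⁻¹)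
      ≤ ∫ u, (2 / (1 - ω) * (X u * testIntegrand A B δ 0 u) + 4 / (1 - ω) * g u)
        ∂(multivariateGaussian 0 B⁻¹) := by
        refine integral_mono hI1 ((hI.const_mul _).add (hg.const_mul _)) fun u => ?_
        change X u * klFun (rexp (δ u)) ≤
          2 / (1 - ω) * (X u * testIntegrand A B δ 0 u) + 4 / (1 - ω) * g u
        by_cases h : X u = 0
        · simpa [h] using mul_nonneg (div_nonneg zero_le_four h1ω.le) (hg0 u)
        · have h1 := klFun_exp_le_testIntegrand hB hA hAB hδ hω3 hloc hω0 hωk hH (hXρ u h)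
          have h2 := mul_le_mul_of_nonneg_left h1 (hX0 u)
          have h3 : X u * |δ u| ≤ g u :=
            (mul_le_of_le_one_left (abs_nonneg _) (hX1 u)).trans (hδg u (hXρ u h))
          have h4 := mul_le_mul_of_nonneg_left h3 (show 0 ≤ 4 / (1 - ω) by positivity)
          linarith
    _ = 2 / (1 - ω) * ∫ u, X u * testIntegrand A B δ 0 u ∂(multivariateGaussian 0 B⁻¹)
        + 4 / (1 - ω) * ∫ u, g u ∂(multivariateGaussian 0 B⁻¹) := by
        rw [integral_add (hI.const_mul _) (hg.const_mul _), integral_const_mul, integral_const_mul]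
    _ ≤ _ := by
        have := mul_nonpos_of_nonneg_of_nonpos (show 0 ≤ 2 / (1 - ω) by positivity) hle
        linarith

omit hA hAB hδ hω3 hloc in
lemma isCompact_qf_le (c : ℝ) : IsCompact {u : E | qf B u ≤ c} := by
  refine Metric.isCompact_of_isClosed_isBounded (isClosed_le (by fun_prop) continuous_const) ?_
  rw [isBounded_iff_forall_norm_le]
  refine ⟨‖toEuclideanCLM (𝕜 := ℝ) (CFC.sqrt B⁻¹)‖ * √c, fun u hu => ?_⟩
  set s := CFC.sqrt B⁻¹
  have hs : s.IsHermitian := isHermitian_sqrt_inv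
  have h1 : s * (s * B) = 1 := by
    rw [← mul_assoc, sqrt_inv_mul_self hB]
    exact Matrix.nonsing_inv_mul _ ((Matrix.isUnit_iff_isUnit_det _).1 hB.isUnit)
  have h4 : B * s * s = 1 := by
    rw [mul_assoc, sqrt_inv_mul_self hB]
    exact Matrix.mul_nonsing_inv _ ((Matrix.isUnit_iff_isUnit_det _).1 hB.isUnit)
  have h2 : ‖toEuclideanCLM (𝕜 := ℝ) (s * B) u‖ ^ 2 = qf B u := by
    rw [← real_inner_self_eq_norm_sq, map_mul, mul_apply_eq_comp,
      ← inner_toEuclideanCLM_comm hs, ← inner_toEuclideanCLM_comm hB.1,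
      ← mul_apply_eq_comp, ← map_mul, ← mul_apply_eq_comp, ← map_mul, h4, qf_eq_inner]
    simp
  have h3 : u = toEuclideanCLM (𝕜 := ℝ) s (toEuclideanCLM (𝕜 := ℝ) (s * B) u) := by
    rw [← mul_apply_eq_comp, ← map_mul, h1]; simp
  calc ‖u‖ = ‖toEuclideanCLM (𝕜 := ℝ) s (toEuclideanCLM (𝕜 := ℝ) (s * B) u)‖ := by rw [← h3]
    _ ≤ ‖toEuclideanCLM (𝕜 := ℝ) s‖ * ‖toEuclideanCLM (𝕜 := ℝ) (s * B) u‖ :=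
      ContinuousLinearMap.le_opNorm _ _
    _ ≤ _ := by
      gcongr
      exact Real.le_sqrt_of_sq_le (h2.trans_le hu)

/-- The bound on the local region `qf A u < ρ`. -/
theorem lintegral_local_le (hω0 : 0 ≤ ω) (hωk : ω * (A * B⁻¹).trace ≤ 2 / 3)
    (hH : ConcaveOn ℝ Set.univ fun u => δ u - qf A u / 2) {g : E → ℝ}
    (hg : Integrable g (multivariateGaussian 0 B⁻¹)) (hg0 : ∀ u, 0 ≤ g u)
    (hδg : ∀ u, qf A u ≤ ρ → |δ u| ≤ g u) :
    ∫⁻ u in {u | qf A u < ρ}, ENNReal.ofReal (klFun (rexp (δ u)))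
      ∂(multivariateGaussian 0 B⁻¹) ≤
      ENNReal.ofReal (4 / (1 - ω) * ∫ u, g u ∂(multivariateGaussian 0 B⁻¹)) := by
  -- The first factor localises to q < ρ, the second makes the support compact, since q may be
  -- degenerate but `qf B` is not. Both are nonincreasing along B⁻¹Au: there q has derivative 2s ≥ 0
  -- and `qf B` has derivative 2q ≥ 0.
  set X : ℕ → E → ℝ := fun n u =>
    smoothTransition (n * (ρ - qf A u)) * smoothTransition (n - qf B u) with hXdef
  have hXs : ∀ n, ContDiff ℝ 1 (X n) := fun n =>
    (smoothTransition.contDiff.comp (contDiff_const.mul (contDiff_const.sub (contDiff_qf A)))).mul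
      (smoothTransition.contDiff.comp (contDiff_const.sub (contDiff_qf B)))
  have hXc : ∀ n, HasCompactSupport (X n) := fun n => by
    refine HasCompactSupport.of_support_subset_isCompact (isCompact_qf_le hB n) fun u hu => ?_
    by_contra h
    refine hu ?_
    have h1 : (n : ℝ) - qf B u ≤ 0 := by linarith [not_le.1 (show ¬ qf B u ≤ n from h)]
    simp [hXdef, smoothTransition.zero_of_nonpos h1]
  have hX0 : ∀ n u, 0 ≤ X n u := fun n u =>
    mul_nonneg (smoothTransition.nonneg _) (smoothTransition.nonneg _)
  have hX1 : ∀ n u, X n u ≤ 1 := fun n u =>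
    mul_le_one₀ (smoothTransition.le_one _) (smoothTransition.nonneg _) (smoothTransition.le_one _)
  have hXρ : ∀ n u, X n u ≠ 0 → qf A u ≤ ρ := by
    intro n u h
    by_contra h1
    refine h ?_
    have h2 : (n : ℝ) * (ρ - qf A u) ≤ 0 :=
      mul_nonpos_of_nonneg_of_nonpos n.cast_nonneg (by linarith [not_le.1 h1])
    simp [hXdef, smoothTransition.zero_of_nonpos h2]
  have hXd : ∀ n u, fderiv ℝ (X n) u (toEuclideanCLM (𝕜 := ℝ) (B⁻¹ * A) u) ≤ 0 := by
    intro n u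
    have hs0 := inner_mul_inv_mul_nonneg hB hA hAB u
    have hs1 := qf_nonneg hA u
    have hst : ∀ x, HasDerivAt smoothTransition (deriv smoothTransition x) x := fun x =>
      ((smoothTransition.contDiff (n := 1)).differentiable one_ne_zero x).hasDerivAt
    have hst0 : ∀ x, 0 ≤ deriv smoothTransition x := fun x =>
      smoothTransition.monotone.deriv_nonneg
    have hd1 := (hst (n * (ρ - qf A u))).comp_hasFDerivAt u
      (((hasFDerivAt_qf hA.1 u).const_sub ρ).const_mul (n : ℝ))
    have hd2 := (hst (n - qf B u)).comp_hasFDerivAt u ((hasFDerivAt_qf hB.1 u).const_sub (n : ℝ))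
    have hd : HasFDerivAt (X n) _ u := hd1.mul hd2
    rw [hd.fderiv]
    simp only [_root_.add_apply, _root_.smul_apply, smul_eq_mul, Function.comp_apply,
      innerSL_apply_apply, _root_.neg_apply]
    rw [inner_inv_mul hB, ← qf_eq_inner]
    have b1 := smoothTransition.nonneg (n * (ρ - qf A u))
    have b2 := smoothTransition.nonneg (n - qf B u)
    have c1 := mul_nonneg (mul_nonneg b1 (hst0 (n - qf B u))) hs1
    have c2 := mul_nonneg (mul_nonneg b2 (hst0 (n * (ρ - qf A u))))
      (mul_nonneg (Nat.cast_nonneg (α := ℝ) n) hs0)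
    linarith
  have hlim : ∀ u, qf A u < ρ → Tendsto (fun n => X n u) atTop (𝓝 1) := by
    intro u hu
    refine tendsto_const_nhds.congr' ?_
    obtain ⟨N1, hN1⟩ := exists_nat_ge (1 / (ρ - qf A u))
    obtain ⟨N2, hN2⟩ := exists_nat_ge (1 + qf B u)
    filter_upwards [eventually_ge_atTop N1, eventually_ge_atTop N2] with n h1 h2
    have h3 : (N1 : ℝ) ≤ n := by exact_mod_cast h1
    have h4 : (N2 : ℝ) ≤ n := by exact_mod_cast h2
    have h5 : 1 ≤ (n : ℝ) * (ρ - qf A u) := by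
      rw [← div_le_iff₀ (by linarith)]; linarith
    simp only [hXdef]
    rw [smoothTransition.one_of_one_le h5, smoothTransition.one_of_one_le (by linarith), one_mul]
  have hδc := hδ.continuous
  have hk := continuous_klFun
  have hXcont : ∀ n, Continuous (X n) := fun n => (hXs n).continuous
  set μ := multivariateGaussian (0 : E) B⁻¹
  have hSm : MeasurableSet {u : E | qf A u < ρ} :=
    measurableSet_lt (by fun_prop) (by fun_prop)
  calc ∫⁻ u in {u | qf A u < ρ}, ENNReal.ofReal (klFun (rexp (δ u))) ∂μ
      = ∫⁻ u in {u | qf A u < ρ}, liminf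
          (fun n => ENNReal.ofReal (X n u * klFun (rexp (δ u)))) atTop ∂μ := by
        refine setLIntegral_congr_fun hSm fun u hu => ?_
        have := (ENNReal.continuous_ofReal.tendsto _).comp
          ((hlim u hu).mul_const (klFun (rexp (δ u))))
        rw [one_mul] at this
        exact this.liminf_eq.symm
    _ ≤ liminf (fun n => ∫⁻ u in {u | qf A u < ρ},
          ENNReal.ofReal (X n u * klFun (rexp (δ u))) ∂μ) atTop := by
        refine lintegral_liminf_le fun n => ?_
        have := hXcont n
        exact (Continuous.measurable (by fun_prop)).ennreal_ofReal
    _ ≤ ENNReal.ofReal (4 / (1 - ω) * ∫ u, g u ∂μ) := by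
        refine liminf_le_of_frequently_le' (Frequently.of_forall fun n => ?_)
        refine (setLIntegral_le_lintegral _ _).trans ?_
        have hc := hXcont n
        have hint : Integrable (fun u => X n u * klFun (rexp (δ u))) μ :=
          Continuous.integrable_of_hasCompactSupport (by fun_prop) (hXc n).mul_right
        rw [← ofReal_integral_eq_lintegral_ofReal hint
          (ae_of_all _ fun u => mul_nonneg (hX0 n u) (klFun_nonneg (Real.exp_pos _).le))]
        exact ENNReal.ofReal_le_ofReal (integral_mul_klFun_exp_le hB hA hAB hδ hω3 hloc hω0 hωk hH
          hg hg0 hδg (hXs n) (hXc n) (hXd n) (hXρ n) (hX0 n) (hX1 n))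

end LocalBoundLimit

/-! ### Scalar estimates for the tail. -/

section TailScalar

lemma klFun_exp_mono {d b : ℝ} (hd : 0 ≤ d) (hdb : d ≤ b) : klFun (rexp d) ≤ klFun (rexp b) := by
  rw [klFun_exp, klFun_exp]
  have h1 : rexp b = rexp d * rexp (b - d) := by rw [← Real.exp_add]; congr 1; ring
  have h2 : (1 - b) * rexp b ≤ (1 - d) * rexp d := by
    rw [h1]
    have h3 : (1 - b) * rexp (b - d) ≤ 1 - d := by
      have h4 := Real.add_one_le_exp (b - d)
      have h5 := exp_sub_one_le (d := b - d)
      nlinarith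
    nlinarith [Real.exp_pos d]
  linarith

lemma klFun_exp_le_one_add {d b : ℝ} (hdb : d ≤ b) :
    klFun (rexp d) ≤ 1 + klFun (rexp b) := by
  rcases le_total d 0 with hd | hd
  · have h1 : klFun (rexp d) ≤ 1 := by
      rw [klFun_exp]; nlinarith [Real.exp_pos d]
    linarith [klFun_nonneg (Real.exp_pos b).le]
  · linarith [klFun_exp_mono hd hdb]

/-- The exponents in the tail integral. -/
lemma tail_exponent_le {k a t c : ℝ} (hk : 0 < k) (ha : 1 / 2 ≤ a) (ht : 0 ≤ t) (hc : c = min 1 k) :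
    (2 * √k + 2 * a + t) * t / 2 - (2 * √k + 2 * a + t - √k) ^ 2 / (2 * c) ≤
      -(2 * a ^ 2) - 1 / 2 - 2 * a - 2 * Real.log (max 1 √k) - a * t := by
  obtain ⟨s, hs⟩ : ∃ s, s = √k := ⟨_, rfl⟩
  have hs0 : 0 < s := hs ▸ Real.sqrt_pos.2 hk
  have hks : k = s ^ 2 := by rw [hs, Real.sq_sqrt hk.le]
  rw [← hs]
  rcases le_total 1 s with h1 | h1
  -- For c = 1 the left side is exactly -2a² - 2as - s²/2 - at. The bound log s ≤ s - 1 leaves the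
  -- product `e`, nonnegative because a ≥ 1/2.
  · have hc1 : c = 1 := by rw [hc, hks]; exact min_eq_left (by nlinarith)
    rw [hc1, max_eq_right h1]
    have := Real.log_le_sub_one_of_pos hs0
    have e : 0 ≤ (s - 1) * (2 * a + (s - 3) / 2) := mul_nonneg (by linarith) (by linarith)
    nlinarith
  · have ha0 : 0 ≤ a := by linarith
    have hc1 : c = s ^ 2 := by rw [hc, hks]; exact min_eq_right (by nlinarith)
    rw [hc1, max_eq_left h1, Real.log_one]
    have hs2 : 0 < s ^ 2 := by positivity
    have hs21 : s ^ 2 ≤ 1 := by nlinarith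
    have key : (2 * s + 2 * a + t) * t / 2 - (2 * s + 2 * a + t - s) ^ 2 / (2 * s ^ 2) =
        (s ^ 2 * ((2 * s + 2 * a + t) * t) - (s + 2 * a + t) ^ 2) / (2 * s ^ 2) := by
      field_simp; ring
    rw [key, div_le_iff₀ (by positivity)]
    have e1 : 0 ≤ (1 - s ^ 2) * (2 * s + 2 * a + t) * t :=
      mul_nonneg (mul_nonneg (by linarith) (by positivity)) ht
    have e2 : 0 ≤ (1 - s) * s * a := mul_nonneg (mul_nonneg (by linarith) hs0.le) ha0
    have e3 : 0 ≤ (1 - s ^ 2) * a ^ 2 := mul_nonneg (by linarith) (by positivity)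
    have e4 : 0 ≤ (1 - s ^ 2) * (a * t) := mul_nonneg (by linarith) (by positivity)
    nlinarith

lemma integral_pow_mul_exp_neg (n : ℕ) {a : ℝ} (ha : 0 < a) :
    IntegrableOn (fun t : ℝ => t ^ n * rexp (-(a * t))) (Set.Ioi 0) ∧
      ∫ t in Set.Ioi (0 : ℝ), t ^ n * rexp (-(a * t)) = n.factorial / a ^ (n + 1) := by
  have h1 := Real.integral_rpow_mul_exp_neg_mul_Ioi (a := n + 1) (r := a) (by positivity) ha
  have h2 : ∫ t in Set.Ioi (0 : ℝ), t ^ n * rexp (-(a * t)) = n.factorial / a ^ (n + 1) := by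
    rw [Real.Gamma_nat_eq_factorial] at h1
    have h3 : ((n : ℝ) + 1) = ((n + 1 : ℕ) : ℝ) := by push_cast; rfl
    simp only [add_sub_cancel_right, Real.rpow_natCast] at h1
    rw [h1, h3, Real.rpow_natCast]
    rw [one_div, inv_pow, inv_mul_eq_div]
  refine ⟨?_, h2⟩
  by_contra h
  rw [integral_undef h] at h2
  have : (0 : ℝ) < n.factorial / a ^ (n + 1) := by positivity
  linarith

lemma integral_tail_polynomial (r : ℝ) {a : ℝ} (ha : 0 < a) :
    IntegrableOn (fun t : ℝ => (r + t) * t / 2 * (r / 2 + t) * rexp (-(a * t))) (Set.Ioi 0) ∧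
      ∫ t in Set.Ioi (0 : ℝ), (r + t) * t / 2 * (r / 2 + t) * rexp (-(a * t))
        = r ^ 2 / (4 * a ^ 2) + 3 * r / (2 * a ^ 3) + 3 / a ^ 4 := by
  have h1 := integral_pow_mul_exp_neg 1 ha
  have h2 := integral_pow_mul_exp_neg 2 ha
  have h3 := integral_pow_mul_exp_neg 3 ha
  have e : (fun t : ℝ => (r + t) * t / 2 * (r / 2 + t) * rexp (-(a * t))) = fun t =>
      r ^ 2 / 4 * (t ^ 1 * rexp (-(a * t))) + 3 * r / 4 * (t ^ 2 * rexp (-(a * t)))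
        + 1 / 2 * (t ^ 3 * rexp (-(a * t))) := by
    ext t; ring
  rw [e]
  have i1 := h1.1.const_mul (r ^ 2 / 4)
  have i2 := h2.1.const_mul (3 * r / 4)
  have i3 := h3.1.const_mul (1 / 2)
  refine ⟨(i1.add i2).add i3, ?_⟩
  refine (integral_add (i1.add i2) i3).trans ?_
  rw [integral_add' i1 i2, integral_const_mul, integral_const_mul,
    integral_const_mul, h1.2, h2.2, h3.2]
  norm_num [Nat.factorial]
  field_simp
  ring

/-- The factor s⁻² from the logarithm cancels the growth r² ~ s². Numerically 1.202 bounds 1/a, then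
21.7 bounds the polynomial divided by s², and 21.7 e⁻² < 3. -/
lemma tail_constant_le {a s r : ℝ} (ha : 0.832 ≤ a) (hs : 1 ≤ s) (hr0 : 0 ≤ r)
    (hr : r ≤ 2 * s + 2 * a) :
    rexp (-(2 * a ^ 2) - 1 / 2 - 2 * a - 2 * Real.log s) *
      (1 + (r ^ 2 / (4 * a ^ 2) + 3 * r / (2 * a ^ 3) + 3 / a ^ 4)) ≤ 3 * rexp (-(2 * a ^ 2)) := by
  have ha0 : 0 < a := by linarith
  have hs0 : 0 < s := by linarith
  obtain ⟨i, hi⟩ : ∃ i, i = a⁻¹ := ⟨_, rfl⟩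
  have hi0 : 0 < i := hi ▸ inv_pos.2 ha0
  have hi1 : i ≤ 1.202 := by
    rw [hi, inv_le_comm₀ ha0 (by norm_num)]
    exact le_trans (by norm_num) ha
  have hia : i * a = 1 := by rw [hi]; exact inv_mul_cancel₀ ha0.ne'
  have hr1 : r * i ≤ 2 * s * (1 + i) := by
    calc r * i ≤ (2 * s + 2 * a) * i := by gcongr
      _ = 2 * s * i + 2 * (i * a) := by ring
      _ ≤ 2 * s * (1 + i) := by rw [hia]; linarith
  have hr2 : r * i ≤ 2 * s * 2.202 := by
    refine hr1.trans ?_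
    gcongr; linarith
  have hri : 0 ≤ r * i := by positivity
  have hP : 1 + (r ^ 2 / (4 * a ^ 2) + 3 * r / (2 * a ^ 3) + 3 / a ^ 4) ≤ s ^ 2 * 21.7 := by
    have e : r ^ 2 / (4 * a ^ 2) + 3 * r / (2 * a ^ 3) + 3 / a ^ 4
        = (r * i) ^ 2 / 4 + 3 / 2 * (r * i) * i ^ 2 + 3 * i ^ 4 := by
      rw [hi]; field_simp
    have e1 : (r * i) ^ 2 ≤ (2 * s * 2.202) ^ 2 := by
      gcongr
    have e2 : r * i * i ^ 2 ≤ 2 * s * 2.202 * 1.202 ^ 2 := by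
      gcongr
    have e3 : i ^ 4 ≤ 1.202 ^ 4 := by gcongr
    have e4 : s ≤ s ^ 2 := by nlinarith
    rw [e]
    nlinarith
  have hE : rexp (-(2 * a ^ 2) - 1 / 2 - 2 * a - 2 * Real.log s)
      = rexp (-(2 * a ^ 2)) * rexp (-(1 / 2 + 2 * a)) * (s ^ 2)⁻¹ := by
    have : (s ^ 2)⁻¹ = rexp (-(2 * Real.log s)) := by
      rw [Real.exp_neg, mul_comm, Real.exp_mul, Real.exp_log hs0]; norm_cast
    rw [this, ← Real.exp_add, ← Real.exp_add]; congr 1; ring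
  have hexp : rexp (-(1 / 2 + 2 * a)) * 21.7 ≤ 3 := by
    rw [Real.exp_neg, inv_mul_le_iff₀ (Real.exp_pos _)]
    have h1 : rexp 2 ≤ rexp (1 / 2 + 2 * a) := Real.exp_le_exp.2 (by linarith)
    have h2 : rexp 2 = rexp 1 * rexp 1 := by rw [← Real.exp_add]; norm_num
    have h3 := Real.exp_one_gt_d9
    nlinarith
  rw [hE]
  calc _ ≤ rexp (-(2 * a ^ 2)) * rexp (-(1 / 2 + 2 * a)) * (s ^ 2)⁻¹ * (s ^ 2 * 21.7) := by
        gcongr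
    _ = rexp (-(2 * a ^ 2)) * (rexp (-(1 / 2 + 2 * a)) * 21.7) := by field_simp
    _ ≤ rexp (-(2 * a ^ 2)) * 3 := by gcongr
    _ = _ := by ring

/-- `klFun (exp ((r + z) z / 2))` as the integral of its derivative. -/
lemma integral_tail_deriv (r z : ℝ) :
    ∫ t in (0 : ℝ)..z, (r + t) * t / 2 * (r / 2 + t) * rexp ((r + t) * t / 2)
      = klFun (rexp ((r + z) * z / 2)) := by
  have hd : ∀ t : ℝ, HasDerivAt (fun t => ((r + t) * t / 2 - 1) * rexp ((r + t) * t / 2) + 1)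
      ((r + t) * t / 2 * (r / 2 + t) * rexp ((r + t) * t / 2)) t := by
    intro t
    have h1 : HasDerivAt (fun t => (r + t) * t / 2) (r / 2 + t) t := by
      have := (((hasDerivAt_id t).const_add r).mul (hasDerivAt_id t)).div_const 2
      refine this.congr_deriv ?_
      simp; ring
    have := ((h1.sub_const 1).mul h1.exp).add_const 1
    refine this.congr_deriv ?_
    ring
  rw [intervalIntegral.integral_eq_sub_of_hasDerivAt (fun t _ => hd t)
    (Continuous.intervalIntegrable (by fun_prop) _ _)]
  simp [klFun_exp]

end TailScalar

/-! ### The bound on the tail region. -/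

section Tail

variable {p : ℕ} {A B : Matrix (Fin p) (Fin p) ℝ} {δ : EuclideanSpace ℝ (Fin p) → ℝ} {ω R r a : ℝ}

local notation "E" => EuclideanSpace ℝ (Fin p)

/-- Outside the local region, concavity bounds the remainder by its linear extrapolation. -/
lemma le_of_sq_le_qf (hA : A.PosSemidef) (hH : ConcaveOn ℝ Set.univ fun u => δ u - qf A u / 2)
    (hR : 0 < R) (hloc : ∀ u, qf A u ≤ R ^ 2 → |δ u| ≤ ω * qf A u / 2) (hr : r ≤ (1 - ω) * R)
    {u : E} (hu : R ^ 2 ≤ qf A u) : δ u ≤ √(qf A u) * (√(qf A u) - r) / 2 := by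
  set y := √(qf A u) with hy
  have hyq : y ^ 2 = qf A u := Real.sq_sqrt (qf_nonneg hA u)
  have hRy : R ≤ y := Real.le_sqrt_of_sq_le hu
  have hy0 : 0 < y := hR.trans_le hRy
  have h0 : δ 0 = 0 := by
    have h1 : qf A (0 : E) = 0 := by simp [qf]
    have := hloc 0 (by rw [h1]; positivity)
    rw [h1, mul_zero, zero_div] at this
    exact abs_nonpos_iff.1 this
  set t := R / y with ht
  have ht0 : 0 ≤ t := by positivity
  have ht1 : t ≤ 1 := (div_le_one hy0).2 hRy
  have hty : t * y = R := div_mul_cancel₀ _ hy0.ne'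
  have hqt : qf A (t • u) = R ^ 2 := by rw [qf_smul, ← hyq, ← mul_pow, hty]
  -- The point tu lies on the sphere q = R², where δ - q/2 ≤ -(1-ω)R²/2 ≤ -rR/2. Concavity on the
  -- segment from 0, where the function vanishes, carries this slope out to u.
  have h1 := hH.2 (Set.mem_univ (0 : E)) (Set.mem_univ u) (show 0 ≤ 1 - t by linarith) ht0 (by ring)
  have h2 := (le_abs_self _).trans (hloc (t • u) hqt.le)
  simp only [smul_zero, zero_add, smul_eq_mul, h0, hqt] at h1 h2
  have h3 : qf A (0 : E) = 0 := by simp [qf]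
  rw [h3] at h1
  have h4 : t * (δ u - qf A u / 2) ≤ -(R * r) / 2 := by nlinarith
  have h5 : R * (δ u - qf A u / 2) ≤ R * (-(y * r) / 2) := by
    calc R * (δ u - qf A u / 2) = y * (t * (δ u - qf A u / 2)) := by rw [← hty]; ring
      _ ≤ y * (-(R * r) / 2) := by gcongr
      _ = _ := by ring
  have h6 := le_of_mul_le_mul_left h5 hR
  rw [← hyq] at h6
  linarith

variable (hB : B.PosDef) (hA : A.PosSemidef)
  (hAB : ∀ u : EuclideanSpace ℝ (Fin p), qf A u ≤ qf B u)

include hB hA hAB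

lemma measureReal_tail_le (ha : 0.832 ≤ a) (hR : 0 < R)
    (hrR : 2 * √(A * B⁻¹).trace + 2 * a ≤ R) :
    (multivariateGaussian 0 B⁻¹).real {u : E | R ^ 2 ≤ qf A u} ≤ rexp (-(2 * a ^ 2)) := by
  have hsub : {u : E | R ^ 2 ≤ qf A u} ⊆ {u : E | 0 < qf A u} := fun u hu =>
    (show 0 < R ^ 2 by positivity).trans_le hu
  rcases (trace_mul_inv_nonneg hB hA hAB).eq_or_lt with hk | hk
  · rw [measureReal_def, measure_mono_null hsub (measure_qf_pos_eq_zero hB hA hAB hk.symm)]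
    simpa using (Real.exp_pos _).le
  · set k := (A * B⁻¹).trace
    have h1 := measureReal_sq_le_qf_le (y := 2 * √k + 2 * a) hB hA hAB hk rfl
      (by linarith [Real.sqrt_nonneg k])
    have h2 := tail_exponent_le hk (show 1 / 2 ≤ a by linarith) le_rfl rfl
    have h3 : 0 ≤ Real.log (max 1 √k) := Real.log_nonneg (le_max_left _ _)
    refine (measureReal_mono fun u hu => ?_).trans (h1.trans (Real.exp_le_exp.2 ?_))
    · exact (show (2 * √k + 2 * a) ^ 2 ≤ R ^ 2 by gcongr).trans hu
    · simp only [add_zero, mul_zero, zero_div, zero_sub] at h2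
      linarith

/-- The bound on the tail region `R² ≤ qf A u`. -/
theorem lintegral_tail_le (ha : 0.832 ≤ a) (hR : 0 < R)
    (hH : ConcaveOn ℝ Set.univ fun u => δ u - qf A u / 2) (hω : 0 ≤ ω)
    (hloc : ∀ u, qf A u ≤ R ^ 2 → |δ u| ≤ ω * qf A u / 2)
    (hrR : 2 * √(A * B⁻¹).trace + 2 * a ≤ (1 - ω) * R) :
    ∫⁻ u in {u : E | R ^ 2 ≤ qf A u}, ENNReal.ofReal (klFun (rexp (δ u)))
      ∂(multivariateGaussian 0 B⁻¹) ≤ ENNReal.ofReal (3 * rexp (-(2 * a ^ 2))) := by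
  have hsub : {u : E | R ^ 2 ≤ qf A u} ⊆ {u : E | 0 < qf A u} := fun u hu =>
    (show 0 < R ^ 2 by positivity).trans_le hu
  rcases (trace_mul_inv_nonneg hB hA hAB).eq_or_lt with hk | hk
  -- If k = 0 then q vanishes almost surely and the tail is a null set.
  · rw [setLIntegral_measure_zero _ _
      (measure_mono_null hsub (measure_qf_pos_eq_zero hB hA hAB hk.symm))]
    exact zero_le
  set μ := multivariateGaussian (0 : E) B⁻¹ with hμ
  set k := (A * B⁻¹).trace with hkdef
  obtain ⟨r, hr⟩ : ∃ r, r = 2 * √k + 2 * a := ⟨_, rfl⟩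
  rw [← hr] at hrR
  have ha0 : 0 < a := by linarith
  have hr0 : 0 < r := by rw [hr]; positivity
  have hrR' : r ≤ R := hrR.trans (mul_le_of_le_one_left hR.le (by linarith))
  set K := rexp (-(2 * a ^ 2) - 1 / 2 - 2 * a - 2 * Real.log (max 1 √k)) with hK
  have hS : ∀ t, 0 ≤ t → μ.real {u : E | (r + t) ^ 2 ≤ qf A u} * rexp ((r + t) * t / 2) ≤
      K * rexp (-(a * t)) := by
    intro t ht
    have h1 := measureReal_sq_le_qf_le (y := r + t) hB hA hAB hk rfl
      (by rw [hr]; linarith [Real.sqrt_nonneg k])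
    have h2 := tail_exponent_le hk (show 1 / 2 ≤ a by linarith) ht rfl
    rw [← hr] at h2
    calc _ ≤ rexp (-((r + t - √k) ^ 2 / (2 * min 1 k))) * rexp ((r + t) * t / 2) := by gcongr
      _ = rexp ((r + t) * t / 2 - (r + t - √k) ^ 2 / (2 * min 1 k)) := by
        rw [← Real.exp_add]; congr 1; ring
      _ ≤ rexp (-(2 * a ^ 2) - 1 / 2 - 2 * a - 2 * Real.log (max 1 √k) - a * t) :=
        Real.exp_le_exp.2 h2
      _ = K * rexp (-(a * t)) := by rw [hK, ← Real.exp_add]; congr 1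
  set f : E → ℝ := fun u => max (√(qf A u) - r) 0 with hf
  set g : ℝ → ℝ := fun t => (r + t) * t / 2 * (r / 2 + t) * rexp ((r + t) * t / 2) with hg
  have hfc : Continuous f := by fun_prop
  have hSm : MeasurableSet {u : E | R ^ 2 ≤ qf A u} := measurableSet_le (by fun_prop) (by fun_prop)
  have hpt : ∀ u ∈ {u : E | R ^ 2 ≤ qf A u}, ENNReal.ofReal (klFun (rexp (δ u))) ≤
      1 + ENNReal.ofReal (∫ t in (0 : ℝ)..f u, g t) := by
    intro u hu
    have h1 := le_of_sq_le_qf hA hH hR hloc hrR hu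
    have h2 : r ≤ √(qf A u) := hrR'.trans (Real.le_sqrt_of_sq_le hu)
    have h3 : f u = √(qf A u) - r := max_eq_left (by linarith)
    rw [integral_tail_deriv, h3, ← ENNReal.ofReal_one,
      ← ENNReal.ofReal_add zero_le_one (klFun_nonneg (Real.exp_pos _).le)]
    refine ENNReal.ofReal_le_ofReal (klFun_exp_le_one_add ?_)
    rwa [show r + (√(qf A u) - r) = √(qf A u) by ring]
  -- Layer cake in t = √q - r, with g the derivative of t ↦ klFun(e^{(r+t)t/2}). The Chernoff bound
  -- absorbs the exponential in g and leaves a polynomial times e^{-at}.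
  have hlayer : ∫⁻ u, ENNReal.ofReal (∫ t in (0 : ℝ)..f u, g t) ∂μ =
      ∫⁻ t in Set.Ioi 0, μ {u | t ≤ f u} * ENNReal.ofReal (g t) := by
    refine lintegral_comp_eq_lintegral_meas_le_mul μ (ae_of_all _ fun u => le_max_right _ _)
      hfc.measurable.aemeasurable (fun t _ => Continuous.intervalIntegrable (by fun_prop) _ _) ?_
    filter_upwards [ae_restrict_mem measurableSet_Ioi] with t ht
    have : 0 < t := ht
    positivity
  obtain ⟨hpi, hpe⟩ := integral_tail_polynomial r ha0
  have hlayer2 : ∫⁻ t in Set.Ioi 0, μ {u | t ≤ f u} * ENNReal.ofReal (g t) ≤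
      ENNReal.ofReal (K * (r ^ 2 / (4 * a ^ 2) + 3 * r / (2 * a ^ 3) + 3 / a ^ 4)) := by
    rw [← hpe, ← integral_const_mul, ofReal_integral_eq_lintegral_ofReal (hpi.const_mul K)]
    · refine setLIntegral_mono_ae (by fun_prop) (ae_of_all _ fun t ht => ?_)
      have ht0 : 0 < t := ht
      have hset : {u : E | t ≤ f u} ⊆ {u : E | (r + t) ^ 2 ≤ qf A u} := by
        intro u hu
        have h1 : t ≤ √(qf A u) - r := (le_max_iff.1 hu).resolve_right (not_le.2 ht0)
        exact (Real.le_sqrt' (by positivity)).1 (by linarith)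
      have h2 : μ {u | t ≤ f u} ≤ ENNReal.ofReal (μ.real {u : E | (r + t) ^ 2 ≤ qf A u}) :=
        (measure_mono hset).trans_eq (ofReal_measureReal).symm
      refine (mul_le_mul_left h2 _).trans ?_
      rw [← ENNReal.ofReal_mul measureReal_nonneg]
      refine ENNReal.ofReal_le_ofReal ?_
      have h3 := mul_le_mul_of_nonneg_left (hS t ht0.le)
        (show 0 ≤ (r + t) * t / 2 * (r / 2 + t) by positivity)
      simp only [hg]
      linarith
    · filter_upwards [ae_restrict_mem measurableSet_Ioi] with t ht
      have : 0 < t := ht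
      have := Real.exp_pos (-(a * t))
      simp only [Pi.zero_apply]
      positivity
  have hone : μ {u : E | R ^ 2 ≤ qf A u} ≤ ENNReal.ofReal K := by
    rw [← ofReal_measureReal (μ := μ)]
    refine ENNReal.ofReal_le_ofReal ?_
    have h1 := hS 0 le_rfl
    simp only [add_zero, mul_zero, zero_div, neg_zero, Real.exp_zero, mul_one] at h1
    refine (measureReal_mono fun u hu => ?_).trans h1
    exact (show r ^ 2 ≤ R ^ 2 by gcongr).trans hu
  calc _ ≤ ∫⁻ u in {u : E | R ^ 2 ≤ qf A u},
          (1 + ENNReal.ofReal (∫ t in (0 : ℝ)..f u, g t)) ∂μ := setLIntegral_mono' hSm hpt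
    _ = μ {u : E | R ^ 2 ≤ qf A u} + ∫⁻ u in {u : E | R ^ 2 ≤ qf A u},
          ENNReal.ofReal (∫ t in (0 : ℝ)..f u, g t) ∂μ := by
        rw [lintegral_add_left measurable_const, setLIntegral_const, one_mul]
    _ ≤ ENNReal.ofReal K + ENNReal.ofReal
          (K * (r ^ 2 / (4 * a ^ 2) + 3 * r / (2 * a ^ 3) + 3 / a ^ 4)) := by
        refine add_le_add hone ((setLIntegral_le_lintegral _ _).trans ?_)
        rw [hlayer]; exact hlayer2
    _ = ENNReal.ofReal (K * (1 + (r ^ 2 / (4 * a ^ 2) + 3 * r / (2 * a ^ 3) + 3 / a ^ 4))) := by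
        rw [← ENNReal.ofReal_add (Real.exp_pos _).le (by positivity)]
        congr 1; ring
    _ ≤ _ := by
        refine ENNReal.ofReal_le_ofReal (tail_constant_le ha (le_max_left _ _) hr0.le ?_)
        rw [hr]
        linarith [le_max_right 1 √k]

end Tail

/-! ### Divergence of a tilted measure. -/

section KL

variable {α : Type*} {mα : MeasurableSpace α}

lemma tilted_add_const (μ : Measure α) (h : α → ℝ) (c : ℝ) :
    μ.tilted (fun x => h x + c) = μ.tilted h := by
  simp only [Measure.tilted, Real.exp_add, integral_mul_const]
  congr 1
  ext x
  rw [mul_div_mul_right _ _ (Real.exp_pos c).ne']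

/-- The Kullback–Leibler divergence of a tilted measure from the original one. -/
lemma klDiv_tilted_le {μ : Measure α} [IsProbabilityMeasure μ] {h : α → ℝ} (hm : Measurable h)
    (hi : Integrable (fun x => rexp (h x)) μ) {M : ℝ} (hM : 0 ≤ M)
    (hle : ∫⁻ x, ENNReal.ofReal (klFun (rexp (h x))) ∂μ ≤ ENNReal.ofReal M) :
    klDiv (μ.tilted h) μ ≤ ENNReal.ofReal (M / ∫ x, rexp (h x) ∂μ) := by
  have := isProbabilityMeasure_tilted hi
  set Z := ∫ x, rexp (h x) ∂μ with hZ
  have hZ0 : 0 < Z := integral_exp_pos hi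
  have hkm : Measurable fun x => klFun (rexp (h x)) := measurable_klFun.comp hm.exp
  have hk0 : ∀ x, 0 ≤ klFun (rexp (h x)) := fun x => klFun_nonneg (Real.exp_pos _).le
  have hki : Integrable (fun x => klFun (rexp (h x))) μ := by
    refine ⟨hkm.aestronglyMeasurable, ?_⟩
    rw [hasFiniteIntegral_iff_ofReal (ae_of_all _ hk0)]
    exact hle.trans_lt ENNReal.ofReal_lt_top
  have hkM : ∫ x, klFun (rexp (h x)) ∂μ ≤ M := by
    rw [← ofReal_integral_eq_lintegral_ofReal hki (ae_of_all _ hk0)] at hle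
    exact (ENNReal.ofReal_le_ofReal_iff hM).1 hle
  have hrn := rnDeriv_tilted_left_self (μ := μ) (f := h) hm.aemeasurable
  rw [klDiv_eq_lintegral_klFun_of_ac (tilted_absolutelyContinuous μ h)]
  have hcongr : ∀ᵐ x ∂μ, klFun ((μ.tilted h).rnDeriv μ x).toReal
      = Z⁻¹ * klFun (rexp (h x)) + (1 - Z⁻¹) - Z⁻¹ * Real.log Z * rexp (h x) := by
    filter_upwards [hrn] with x hx
    rw [hx, ← hZ, ENNReal.toReal_ofReal (by positivity), klFun_exp, klFun_apply,
      Real.log_div (Real.exp_pos _).ne' hZ0.ne', Real.log_exp]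
    field_simp; ring
  have hI : Integrable (fun x => Z⁻¹ * klFun (rexp (h x)) + (1 - Z⁻¹)
      - Z⁻¹ * Real.log Z * rexp (h x)) μ :=
    ((hki.const_mul _).add (integrable_const _)).sub (hi.const_mul _)
  have hI' : Integrable (fun x => klFun ((μ.tilted h).rnDeriv μ x).toReal) μ :=
    hI.congr (hcongr.mono fun x hx => hx.symm)
  rw [← ofReal_integral_eq_lintegral_ofReal hI'
    (ae_of_all _ fun x => klFun_nonneg ENNReal.toReal_nonneg), integral_congr_ae hcongr]
  refine ENNReal.ofReal_le_ofReal ?_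
  have hval : ∫ x, (Z⁻¹ * klFun (rexp (h x)) + (1 - Z⁻¹) - Z⁻¹ * Real.log Z * rexp (h x)) ∂μ
      = Z⁻¹ * ∫ x, klFun (rexp (h x)) ∂μ + (1 - Z⁻¹) - Z⁻¹ * Real.log Z * Z := by
    refine (integral_sub ((hki.const_mul Z⁻¹).add (integrable_const (1 - Z⁻¹)))
      (hi.const_mul (Z⁻¹ * Real.log Z))).trans ?_
    rw [integral_add' (hki.const_mul _) (integrable_const _), integral_const_mul,
      integral_const_mul]
    simp [← hZ]
  rw [hval, div_eq_inv_mul]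
  -- This disposes of the leftover term 1 - 1/Z - log Z.
  have h1 := Real.one_sub_inv_le_log_of_pos hZ0
  have h2 : Z⁻¹ * Real.log Z * Z = Real.log Z := by field_simp
  have h3 := mul_le_mul_of_nonneg_left hkM (inv_pos.2 hZ0).le
  linarith

end KL

/-! ### Perturbed Gaussians: local and tail bounds combined. -/

section Gaussian

variable {p : ℕ} {A B : Matrix (Fin p) (Fin p) ℝ} {δ : EuclideanSpace ℝ (Fin p) → ℝ} {ω R a : ℝ}

local notation "E" => EuclideanSpace ℝ (Fin p)

/-- A perturbation `exp δ` of a centred Gaussian measure, with `δ` small relative to `qf A` on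
`qf A u ≤ R²` and `δ - qf A / 2` concave, is close to it in Kullback–Leibler divergence. -/
theorem klDiv_tilted_multivariateGaussian_le (hB : B.PosDef) (hA : A.PosSemidef)
    (hAB : ∀ u : E, qf A u ≤ qf B u) (hδ : ContDiff ℝ 1 δ) (hω0 : 0 ≤ ω) (hω3 : ω ≤ 1 / 3)
    (hR : 0 < R) (ha : 0.832 ≤ a) (hloc : ∀ u, qf A u ≤ R ^ 2 → |δ u| ≤ ω * qf A u / 2)
    (hωk : ω * (A * B⁻¹).trace ≤ 2 / 3) (hrR : 2 * √(A * B⁻¹).trace + 2 * a ≤ (1 - ω) * R)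
    (hH : ConcaveOn ℝ Set.univ fun u => δ u - qf A u / 2) {g : E → ℝ}
    (hg : Integrable g (multivariateGaussian 0 B⁻¹)) (hg0 : ∀ u, 0 ≤ g u)
    (hδg : ∀ u, qf A u ≤ R ^ 2 → |δ u| ≤ g u)
    (hi : Integrable (fun u => rexp (δ u)) (multivariateGaussian 0 B⁻¹))
    (hsmall : ∫ u, g u ∂(multivariateGaussian 0 B⁻¹) + rexp (-(2 * a ^ 2)) ≤ 1 / 4) :
    klDiv ((multivariateGaussian 0 B⁻¹).tilted δ) (multivariateGaussian 0 B⁻¹) ≤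
      ENNReal.ofReal (4 / 3 * (4 / (1 - ω) * ∫ u, g u ∂(multivariateGaussian 0 B⁻¹)
        + 3 * rexp (-(2 * a ^ 2)))) := by
  set μ := multivariateGaussian (0 : E) B⁻¹ with hμ
  have hg1 : 0 ≤ ∫ u, g u ∂μ := integral_nonneg hg0
  have hω1 : 0 < 1 - ω := by linarith
  set S := {u : E | qf A u < R ^ 2} with hS
  have hSm : MeasurableSet S := measurableSet_lt (by fun_prop) (by fun_prop)
  have hSc : Sᶜ = {u : E | R ^ 2 ≤ qf A u} := by ext u; simp [hS]
  set M := 4 / (1 - ω) * ∫ u, g u ∂μ + 3 * rexp (-(2 * a ^ 2)) with hM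
  have hM0 : 0 ≤ M := by positivity
  have hle : ∫⁻ u, ENNReal.ofReal (klFun (rexp (δ u))) ∂μ ≤ ENNReal.ofReal M := by
    rw [← lintegral_add_compl _ hSm, hM, ENNReal.ofReal_add (by positivity) (by positivity), hSc]
    exact add_le_add (lintegral_local_le hB hA hAB hδ hω3 hloc hω0 hωk hH hg hg0 hδg)
      (lintegral_tail_le hB hA hAB ha hR hH hω0 hloc hrR)
  have hSi : Integrable (S.indicator (1 : E → ℝ)) μ := (integrable_const (1 : ℝ)).indicator hSm
  -- On S, e^δ ≥ 1 + δ ≥ 1 - g, hence Z ≥ μ(S) - ∫ g ≥ 1 - e^{-2a²} - ∫ g.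
  have hZ : 3 / 4 ≤ ∫ u, rexp (δ u) ∂μ := by
    have h1 : ∫ u, (S.indicator 1 u - g u) ∂μ ≤ ∫ u, rexp (δ u) ∂μ := by
      refine integral_mono (hSi.sub hg) hi fun u => ?_
      by_cases hu : u ∈ S
      · simp only [Set.indicator_of_mem hu, Pi.one_apply]
        linarith [neg_abs_le (δ u), hδg u (le_of_lt hu), Real.add_one_le_exp (δ u)]
      · simp only [Set.indicator_of_notMem hu]
        linarith [hg0 u, Real.exp_pos (δ u)]
    have h2 : ∫ u, (S.indicator 1 u - g u) ∂μ = μ.real S - ∫ u, g u ∂μ := by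
      rw [integral_sub hSi hg, integral_indicator_one hSm]
    have h3 := measureReal_tail_le hB hA hAB ha hR
      (hrR.trans (mul_le_of_le_one_left hR.le (by linarith)))
    rw [← hSc, probReal_compl_eq_one_sub hSm] at h3
    linarith
  refine (klDiv_tilted_le hδ.continuous.measurable hi hM0 hle).trans ?_
  refine ENNReal.ofReal_le_ofReal ?_
  rw [div_le_iff₀ (by linarith)]
  nlinarith

/-- The relative entropy of `exp f` with respect to a Gaussian measure centred at `a` does not
exceed that of the corresponding perturbation of the centred Gaussian measure. -/
lemma klDiv_tilted_multivariateGaussian_le_centred (hB : B.PosDef) {f : E → ℝ} {a : E} {c : ℝ}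
    (hf : Measurable f) (hfδ : ∀ u, f (a + u) = -(qf B u / 2) + δ u + c) :
    klDiv (volume.tilted f) (multivariateGaussian a B⁻¹) ≤
      klDiv ((multivariateGaussian 0 B⁻¹).tilted δ) (multivariateGaussian 0 B⁻¹) := by
  have he : Measurable fun u : E => a + u := by fun_prop
  have hvol : (volume : Measure E).map (fun u => a + u) = volume :=
    (measurePreserving_add_left volume a).map_eq
  have h0 : multivariateGaussian (0 : E) B⁻¹ = volume.tilted (fun y : E => -(qf B y / 2)) := by
    simpa using multivariateGaussian_eq_tilted hB (0 : E)
  have hi0 : Integrable (fun y : E => rexp (-(qf B y / 2))) := by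
    simpa using integrable_exp_neg_qf hB (0 : E)
  have h1 : multivariateGaussian a B⁻¹ =
      (multivariateGaussian (0 : E) B⁻¹).map fun u => a + u := by
    have := map_tilted (μ := volume) he (g := fun y : E => -(qf B (y - a) / 2)) (by fun_prop)
    rw [hvol, ← multivariateGaussian_eq_tilted hB a] at this
    rw [← this, h0]
    congr 2
    ext u
    simp
  have h2 : volume.tilted f =
      ((multivariateGaussian (0 : E) B⁻¹).tilted δ).map fun u => a + u := by
    have := map_tilted (μ := volume) he hf
    rw [hvol] at this
    have e : f ∘ (fun u => a + u) = fun u => ((fun y : E => -(qf B y / 2)) + δ) u + c :=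
      funext hfδ
    rw [← this, e, tilted_add_const, h0, tilted_tilted hi0]
  rw [h1, h2]
  -- Both measures are pushed forward by the same translation, so data processing suffices.
  exact klDiv_map_le _ _ he

lemma integrable_exp_of_gaussian_factor (hB : B.PosDef) {f : E → ℝ} {a : E} {c : ℝ}
    (hf : Integrable fun y => rexp (f y)) (hfδ : ∀ u, f (a + u) = -(qf B u / 2) + δ u + c) :
    Integrable (fun u => rexp (δ u)) (multivariateGaussian 0 B⁻¹) := by
  have h0 : multivariateGaussian (0 : E) B⁻¹ = volume.tilted (fun y : E => -(qf B y / 2)) := by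
    simpa using multivariateGaussian_eq_tilted hB (0 : E)
  have hi0 : Integrable (fun y : E => rexp (-(qf B y / 2))) := by
    simpa using integrable_exp_neg_qf hB (0 : E)
  rw [h0, integrable_tilted_iff hi0]
  refine ((hf.comp_add_left a).mul_const (rexp (-c))).congr (ae_of_all _ fun u => ?_)
  simp only [hfδ, smul_eq_mul, ← Real.exp_add]
  congr 1
  ring

end Gaussian

/-! ### The Taylor remainder meets the abstract hypotheses. -/

section Remainder

variable {p : ℕ} {f : EuclideanSpace ℝ (Fin p) → ℝ} {xs : EuclideanSpace ℝ (Fin p)}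
  {G2 : Matrix (Fin p) (Fin p) ℝ} {x ν : ℝ}

local notation "E" => EuclideanSpace ℝ (Fin p)

lemma mem_localSet_iff (hR : 0 ≤ ν⁻¹ * radius f xs G2 x) {u : E} :
    u ∈ localSet f xs G2 x ν ↔ qf (D2 f xs G2) u ≤ (ν⁻¹ * radius f xs G2 x) ^ 2 :=
  Real.sqrt_le_left hR

/-- The bound stays in extended reals because the sign of `qf (D2 f xs G2) u` is not yet known. If
it is nonpositive, finiteness of ω forces δ₃ to vanish, and this is how `posSemidef_D2` gets its
contradiction. -/
lemma ofReal_abs_delta3_le (hω : omega f xs G2 x ν ≠ ∞) {u : E}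
    (hu : u ∈ localSet f xs G2 x ν) :
    ENNReal.ofReal |delta3 f xs u| ≤
      omega f xs G2 x ν * ENNReal.ofReal (qf (D2 f xs G2) u / 2) := by
  have h : ENNReal.ofReal |delta3 f xs u| / ENNReal.ofReal (qf (D2 f xs G2) u / 2) ≤
      omega f xs G2 x ν :=
    le_iSup₂ (f := fun u (_ : u ∈ localSet f xs G2 x ν) =>
      ENNReal.ofReal |delta3 f xs u| / ENNReal.ofReal (qf (D2 f xs G2) u / 2)) u hu
  exact (ENNReal.div_le_iff_le_mul (Or.inr hω) (Or.inl ENNReal.ofReal_ne_top)).1 h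

lemma abs_delta3_le (hω : omega f xs G2 x ν ≠ ∞) {u : E} (hu : u ∈ localSet f xs G2 x ν)
    (hq : 0 ≤ qf (D2 f xs G2) u) :
    |delta3 f xs u| ≤ (omega f xs G2 x ν).toReal * qf (D2 f xs G2) u / 2 := by
  have h := ofReal_abs_delta3_le hω hu
  rw [← ENNReal.ofReal_toReal hω, ← ENNReal.ofReal_mul ENNReal.toReal_nonneg,
    ENNReal.ofReal_le_ofReal_iff (by positivity)] at h
  rwa [mul_div_assoc]

lemma delta3_eq (h0 : fderiv ℝ f xs = 0) (u : E) :
    delta3 f xs u = f (xs + u) - f xs + qf (DG2 f xs) u / 2 := by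
  simp [delta3, DG2, h0, qf_neg_left]
  ring

/-- Up to the constant f(x*), this is the function assumed concave: adding B/2 and subtracting (B -
G²)/2 leaves G²/2. -/
lemma concaveOn_delta3_sub (h0 : fderiv ℝ f xs = 0)
    (hconc : ConcaveOn ℝ Set.univ (fun u => f (xs + u) + qf G2 u / 2)) :
    ConcaveOn ℝ Set.univ fun u => delta3 f xs u - qf (D2 f xs G2) u / 2 := by
  refine (hconc.add (concaveOn_const (-f xs) convex_univ)).congr fun u _ => ?_
  simp only [delta3_eq h0, D2, qf_sub_left, Pi.add_apply]
  ring

lemma contDiff_delta3 (hf : ContDiff ℝ 2 f) : ContDiff ℝ 1 (delta3 f xs) := by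
  have h1 : ContDiff ℝ 1 fun u : E => f (xs + u) :=
    (hf.of_le one_le_two).comp (contDiff_const.add contDiff_id)
  exact ((h1.sub contDiff_const).sub (fderiv ℝ f xs).contDiff).sub
    ((contDiff_qf (hessian f xs)).div_const 2)

/-- `D²` is positive semidefinite: on a direction of negative curvature, the remainder vanishes
on `U`, which contradicts concavity. -/
lemma posSemidef_D2 (hB : (DG2 f xs).IsHermitian) (hG : G2.IsHermitian)
    (hH : ConcaveOn ℝ Set.univ fun u => delta3 f xs u - qf (D2 f xs G2) u / 2)
    (hω : omega f xs G2 x ν ≠ ∞) (hR : 0 ≤ ν⁻¹ * radius f xs G2 x) : (D2 f xs G2).PosSemidef := by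
  have key : ∀ u : E, 0 ≤ qf (D2 f xs G2) u := by
    intro v
    by_contra! hv
    have hδ : ∀ u : E, qf (D2 f xs G2) u ≤ 0 → delta3 f xs u = 0 := by
      intro u hu
      have := ofReal_abs_delta3_le hω ((mem_localSet_iff hR).2 (hu.trans (sq_nonneg _)))
      rw [ENNReal.ofReal_of_nonpos (p := qf (D2 f xs G2) u / 2) (by linarith), mul_zero,
        nonpos_iff_eq_zero, ENNReal.ofReal_eq_zero] at this
      exact abs_nonpos_iff.1 this
    have hv' : qf (D2 f xs G2) (-v) = qf (D2 f xs G2) v := by simp [qf, Matrix.mulVec_neg]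
    have h00 : qf (D2 f xs G2) (0 : E) = 0 := by simp [qf]
    have := hH.2 (Set.mem_univ v) (Set.mem_univ (-v)) (show (0 : ℝ) ≤ 1 / 2 by norm_num)
      (show (0 : ℝ) ≤ 1 / 2 by norm_num) (by norm_num)
    simp only [smul_neg, add_neg_cancel, hv', h00, hδ v hv.le, hδ (-v) (hv'.trans_le hv.le),
      hδ 0 h00.le, smul_eq_mul] at this
    linarith
  refine Matrix.PosSemidef.of_dotProduct_mulVec_nonneg (hB.sub hG) fun v => ?_
  simpa [qf] using key (toLp 2 v)

end Remainder

lemma radius_pos {p : ℕ} (f : EuclideanSpace ℝ (Fin p) → ℝ) (xs : EuclideanSpace ℝ (Fin p))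
    (G2 : Matrix (Fin p) (Fin p) ℝ) {x : ℝ} (hx : 0 < x) : 0 < radius f xs G2 x := by
  unfold radius
  positivity

/-- A positively homogeneous function of degree three that is nonnegative on a neighbourhood
`qf A u ≤ c` of the origin is nonnegative. -/
lemma nonneg_of_homogeneous {p : ℕ} {A : Matrix (Fin p) (Fin p) ℝ} {c : ℝ} (hc : 0 < c)
    {τ : EuclideanSpace ℝ (Fin p) → ℝ}
    (hhom : ∀ (t : ℝ) (u : EuclideanSpace ℝ (Fin p)), 0 < t → τ (t • u) = t ^ 3 * τ u)
    (hτ : ∀ u, qf A u ≤ c → 0 ≤ τ u) (u : EuclideanSpace ℝ (Fin p)) : 0 ≤ τ u := by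
  obtain ⟨t, ht0, ht⟩ : ∃ t : ℝ, 0 < t ∧ t ^ 2 * qf A u ≤ c := by
    refine ⟨√(c / (|qf A u| + 1)), by positivity, ?_⟩
    rw [Real.sq_sqrt (by positivity), div_mul_eq_mul_div, div_le_iff₀ (by positivity)]
    nlinarith [le_abs_self (qf A u)]
  have := hτ (t • u) (by rwa [qf_smul])
  rw [hhom t u ht0] at this
  exact nonneg_of_mul_nonneg_right this (by positivity)

lemma rpow_three_halves_le {s : ℝ} (h0 : 0 < s) (h1 : s ≤ 1) : s ^ (3 / 2 : ℝ) ≤ s := by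
  calc s ^ (3 / 2 : ℝ) ≤ s ^ (1 : ℝ) := Real.rpow_le_rpow_of_exponent_ge h0 h1 (by norm_num)
    _ = s := Real.rpow_one s

/-- Here x ≥ log 4, and 0.832 is √(2 log 4)/2 rounded down. -/
lemma sqrt_two_mul_ge {x : ℝ} (h : 4 * rexp (-x) ≤ 1) : 2 * 0.832 ≤ √(2 * x) := by
  refine Real.le_sqrt_of_sq_le ?_
  have h1 : -x ≤ Real.log (1 / 4) := by
    rw [Real.le_log_iff_exp_le (by norm_num)]
    linarith
  have h2 : Real.log (1 / 4) = -(2 * Real.log 2) := by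
    rw [show (1 / 4 : ℝ) = (2 ^ 2)⁻¹ by norm_num, Real.log_inv, Real.log_pow]
    norm_num
  have := Real.log_two_gt_d9
  norm_num
  linarith

end LaplaceKL

/-! ### Assembly of the bounds. -/

theorem mainTheorem3 {p : ℕ}
    (f : EuclideanSpace ℝ (Fin p) → ℝ) (hf : ContDiff ℝ 2 f)
    (hint : Integrable (fun y => Real.exp (f y)) volume)
    (xs : EuclideanSpace ℝ (Fin p)) (hmax : ∀ y, f y ≤ f xs)
    (hpos : (LaplaceKL.DG2 f xs).PosDef)
    (G2 : Matrix (Fin p) (Fin p) ℝ) (hG2 : G2.PosSemidef)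
    (hconc : ConcaveOn ℝ Set.univ (fun u => f (xs + u) + LaplaceKL.qf G2 u / 2))
    (x : ℝ) (hx : 0 < x) (ν : ℝ) (hν0 : 0 < ν) (hν1 : ν < 1)
    (hω : LaplaceKL.omega f xs G2 x ν ≤ ENNReal.ofReal (1 / 3))
    (hων : LaplaceKL.omega f xs G2 x ν ≤ ENNReal.ofReal (1 - ν))
    (hωp : (LaplaceKL.omega f xs G2 x ν).toReal * LaplaceKL.effDim f xs G2 ≤ 2 / 3)
    (τ₃ : EuclideanSpace ℝ (Fin p) → ℝ)
    (hhom : ∀ (t : ℝ) (u : EuclideanSpace ℝ (Fin p)), 0 < t → τ₃ (t • u) = t ^ 3 * τ₃ u)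
    (hτ : ∀ u ∈ LaplaceKL.localSet f xs G2 x ν, |LaplaceKL.delta3 f xs u| ≤ τ₃ u / 6)
    (hτint : Integrable τ₃
      (ProbabilityTheory.multivariateGaussian 0 (LaplaceKL.DG2 f xs)⁻¹))
    (hsmall : 4 * LaplaceKL.diamond3 f xs G2 x ν τ₃ + 4 * Real.exp (-x) ≤ 1) :
    InformationTheory.klDiv (volume.tilted f)
        (ProbabilityTheory.multivariateGaussian xs (LaplaceKL.DG2 f xs)⁻¹) ≤
      ENNReal.ofReal (4 * LaplaceKL.diamond3 f xs G2 x ν τ₃ + 4 * Real.exp (-x)) := by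
  open LaplaceKL in
  set w := (omega f xs G2 x ν).toReal with hw
  have hωtop : omega f xs G2 x ν ≠ ∞ := (hω.trans_lt ENNReal.ofReal_lt_top).ne
  have hw0 : 0 ≤ w := ENNReal.toReal_nonneg
  have hw3 : w ≤ 1 / 3 := ENNReal.toReal_le_of_le_ofReal (by norm_num) hω
  have hwν : w ≤ 1 - ν := ENNReal.toReal_le_of_le_ofReal (by linarith) hων
  have hr := radius_pos f xs G2 hx
  have hR : 0 < ν⁻¹ * radius f xs G2 x := by positivity
  have hd : fderiv ℝ f xs = 0 := IsLocalMax.fderiv_eq_zero (Filter.Eventually.of_forall hmax)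
  have hH := concaveOn_delta3_sub hd hconc
  have hA := posSemidef_D2 hpos.1 hG2.1 hH hωtop hR.le
  have hAB : ∀ u, qf (D2 f xs G2) u ≤ qf (DG2 f xs) u := fun u => by
    rw [D2, qf_sub_left]
    linarith [qf_nonneg hG2 u]
  have hτ' : ∀ u, qf (D2 f xs G2) u ≤ (ν⁻¹ * radius f xs G2 x) ^ 2 → |delta3 f xs u| ≤ τ₃ u / 6 :=
    fun u hu => hτ u ((mem_localSet_iff hR.le).2 hu)
  have hτ0 : ∀ u, 0 ≤ τ₃ u := nonneg_of_homogeneous (pow_pos hR 2) hhom fun u hu => by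
    linarith [hτ' u hu, abs_nonneg (delta3 f xs u)]
  have hfδ : ∀ u, f (xs + u) = -(qf (DG2 f xs) u / 2) + delta3 f xs u + f xs := fun u => by
    rw [delta3_eq hd]; ring
  set T := ∫ u, τ₃ u ∂(ProbabilityTheory.multivariateGaussian 0 (DG2 f xs)⁻¹) with hT
  have hT0 : 0 ≤ T := integral_nonneg hτ0
  have hdia : T / (1 - w) ≤ 4 * diamond3 f xs G2 x ν τ₃ := by
    have h1 : 0 < (1 - w) ^ (3 / 2 : ℝ) := Real.rpow_pos_of_pos (by linarith) _
    have h2 : 4 * diamond3 f xs G2 x ν τ₃ = T / (1 - w) ^ (3 / 2 : ℝ) := by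
      rw [diamond3, ← hT, ← hw]
      field_simp
    rw [h2]
    exact div_le_div_of_nonneg_left hT0 h1 (rpow_three_halves_le (by linarith) (by linarith))
  have hT1 : T ≤ T / (1 - w) := by
    rw [le_div_iff₀ (by linarith)]
    nlinarith
  have ha := sqrt_two_mul_ge (x := x) (by linarith)
  -- The parameter a of the tail bound is √(2x)/2, so that r_G = 2√k + 2a and e^{-2a²} = e^{-x}.
  have hax : 2 * (√(2 * x) / 2) ^ 2 = x := by
    rw [div_pow, Real.sq_sqrt (by positivity)]; ring
  have hrR : 2 * √(D2 f xs G2 * (DG2 f xs)⁻¹).trace + 2 * (√(2 * x) / 2) ≤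
      (1 - w) * (ν⁻¹ * radius f xs G2 x) := by
    -- This is where ω ≤ 1 - ν enters: r_G = νR ≤ (1 - ω)R.
    calc _ = ν * (ν⁻¹ * radius f xs G2 x) := by
          rw [mul_inv_cancel_left₀ hν0.ne', radius, effDim]; ring
      _ ≤ _ := by gcongr; linarith
  have hgi : ∫ u, τ₃ u / 6 ∂(ProbabilityTheory.multivariateGaussian 0 (DG2 f xs)⁻¹) = T / 6 :=
    integral_div _ _
  refine (klDiv_tilted_multivariateGaussian_le_centred hpos hf.continuous.measurable hfδ).trans ?_
  refine (klDiv_tilted_multivariateGaussian_le hpos hA hAB (contDiff_delta3 hf) hw0 hw3 hR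
    (by linarith) (fun u hu => abs_delta3_le hωtop ((mem_localSet_iff hR.le).2 hu)
      (qf_nonneg hA u)) hωp hrR hH (hτint.div_const 6) (fun u => div_nonneg (hτ0 u) (by norm_num))
      hτ' (integrable_exp_of_gaussian_factor hpos hint hfδ) ?_).trans ?_
  · rw [hgi, hax]
    linarith
  · rw [hgi, hax]
    refine ENNReal.ofReal_le_ofReal ?_
    -- After the factor 4/3 = 1/(3/4), the local term is 8/9 · T/(1-ω), below T/(1-ω)^{3/2} = 4♦₃,
    -- and the tail term is exactly 4e^{-x}.
    have : 4 / (1 - w) * (T / 6) = 2 / 3 * (T / (1 - w)) := by ring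
    have h2 : 0 ≤ T / (1 - w) := hT0.trans hT1
    rw [this]
    linarith
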